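/- Let $\mathbb P$ be a countable set of propositional variables, effectively presented (its elements are coded by natural numbers, e.g. $\mathbb P=\mathbb N$ or $\mathbb P$ finite), and let $\mathcal L$ be the set of formulas given by the grammar $$\varphi,\psi ::= p \mid \bot \mid \varphi\wedge\psi \mid \varphi\vee\psi \mid \varphi\to\psi \mid \bigcirc\varphi \mid \Diamond\varphi \mid \Box\varphi \qquad (p\in\mathbb P).$$ An \emph{intuitionistic dynamic model} is a tuple $\mathcal M=(W,\preccurlyeq,S,V)$, where $W$ is a non-empty set, $\preccurlyeq$ is a partial order on $W$, $S\colon W\to W$ is a function such that $w\preccurlyeq v$ implies $S(w)\preccurlyeq S(v)$ (forward confluence), and $V$ assigns to each $w\in W$ a set $V(w)\subseteq\mathbb P$ such that $w\preccurlyeq v$ implies $V(w)\subseteq V(v)$. Satisfaction is defined inductively: $\mathcal M,w\models p$ iff $p\in V(w)$; $\mathcal M,w\models\bot$ never; $\wedge$ and $\vee$ are interpreted pointwise; $\mathcal M,w\models\varphi\to\psi$ iff for all $v\succcurlyeq w$, $\mathcal M,v\models\varphi$ implies $\mathcal M,v\models\psi$; $\mathcal M,w\models\bigcirc\varphi$ iff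 $\mathcal M,S(w)\models\varphi$; $\mathcal M,w\models\Diamond\varphi$ iff $\mathcal M,S^k(w)\models\varphi$ for some $k\ge 0$; and $\mathcal M,w\models\Box\varphi$ iff $\mathcal M,S^k(w)\models\varphi$ for all $k\ge 0$. A formula is \emph{satisfiable} for $\mathsf{ITL^e}$ if it is satisfied at some world of some intuitionistic dynamic model, and \emph{valid} for $\mathsf{ITL^e}$ if it is satisfied at every world of every intuitionistic dynamic model. Then the satisfiability problem and the validity problem for $\mathsf{ITL^e}$ are decidable: the set of satisfiable formulas and the set of valid formulas of $\mathcal L$ are both computable (recursive). -/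

import Mathlib

universe u v

namespace ITL

/-- Formulas of the language of linear temporal logic over the propositional variables `P`. -/
inductive Formula (P : Type*) where
  | var (p : P) : Formula P
  | bot : Formula P
  | and (φ ψ : Formula P) : Formula P
  | or (φ ψ : Formula P) : Formula P
  | imp (φ ψ : Formula P) : Formula P
  | next (φ : Formula P) : Formula P
  | diamond (φ : Formula P) : Formula P
  | box (φ : Formula P) : Formula P

/-- A dynamic poset: a non-empty partial order with a forward confluent (that is, monotone)
successor function. -/
structure DynamicPoset where
  W : Type u
  [nonempty : Nonempty W]
  [order : PartialOrder W]
  S : W → W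
  confluent : ∀ w v : W, w ≤ v → S w ≤ S v

attribute [instance] DynamicPoset.nonempty DynamicPoset.order

/-- An intuitionistic dynamic model over the propositional variables `P`. -/
structure Model (P : Type v) extends DynamicPoset.{u} where
  V : W → Set P
  monotone : ∀ w v : W, w ≤ v → V w ⊆ V v

/-- The satisfaction relation. -/
def Sat {P : Type v} (M : Model.{u} P) : M.W → Formula P → Prop
  | w, .var p => p ∈ M.V w
  | _, .bot => False
  | w, .and φ ψ => Sat M w φ ∧ Sat M w ψ
  | w, .or φ ψ => Sat M w φ ∨ Sat M w ψ
  | w, .imp φ ψ => ∀ v, w ≤ v → Sat M v φ → Sat M v ψ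
  | w, .next φ => Sat M (M.S w) φ
  | w, .diamond φ => ∃ k : ℕ, Sat M (M.S^[k] w) φ
  | w, .box φ => ∀ k : ℕ, Sat M (M.S^[k] w) φ

/-- Satisfiability over the class of all intuitionistic dynamic models. -/
def Satisfiable {P : Type v} (φ : Formula P) : Prop :=
  ∃ (M : Model.{u} P) (w : M.W), Sat M w φ

/-- Validity over the class of all intuitionistic dynamic models. -/
def Valid {P : Type v} (φ : Formula P) : Prop :=
  ∀ (M : Model.{u} P) (w : M.W), Sat M w φ

namespace Formula

/-- The Gödel number of a formula, given an encoding of the propositional variables. -/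
def toNat {P : Type v} [Encodable P] : Formula P → ℕ
  | .bot => 0
  | .var p => 7 * Encodable.encode p + 1
  | .next φ => 7 * toNat φ + 2
  | .diamond φ => 7 * toNat φ + 3
  | .box φ => 7 * toNat φ + 4
  | .and φ ψ => 7 * Nat.pair (toNat φ) (toNat ψ) + 5
  | .or φ ψ => 7 * Nat.pair (toNat φ) (toNat ψ) + 6
  | .imp φ ψ => 7 * Nat.pair (toNat φ) (toNat ψ) + 7

/-- The formula with a given Gödel number, if there is one. -/
def ofNat {P : Type v} [Encodable P] : ℕ → Option (Formula P)
  | 0 => some .bot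
  | n + 1 =>
    have h0 : n / 7 < n + 1 := Nat.lt_succ_of_le (Nat.div_le_self n 7)
    have h1 : (n / 7).unpair.1 < n + 1 := (Nat.unpair_left_le _).trans_lt h0
    have h2 : (n / 7).unpair.2 < n + 1 := (Nat.unpair_right_le _).trans_lt h0
    if n % 7 = 0 then (Encodable.decode (n / 7)).map .var
    else if n % 7 = 1 then (ofNat (n / 7)).map .next
    else if n % 7 = 2 then (ofNat (n / 7)).map .diamond
    else if n % 7 = 3 then (ofNat (n / 7)).map .box
    else (ofNat (n / 7).unpair.1).bind fun φ => (ofNat (n / 7).unpair.2).map fun ψ =>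
      if n % 7 = 4 then .and φ ψ else if n % 7 = 5 then .or φ ψ else .imp φ ψ

theorem ofNat_toNat {P : Type v} [Encodable P] (φ : Formula P) : ofNat (toNat φ) = some φ := by
  have hd : ∀ a r, r < 7 → (7 * a + r) / 7 = a := by intros; omega
  have hm : ∀ a r, r < 7 → (7 * a + r) % 7 = r := by intros; omega
  have hd0 : ∀ a, (7 * a) / 7 = a := by intros; omega
  have hm0 : ∀ a, (7 * a) % 7 = 0 := by intros; omega
  induction φ <;> simp_all [toNat, ofNat]

instance {P : Type v} [Encodable P] : Encodable (Formula P) where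
  encode := toNat
  decode := ofNat
  encodek := ofNat_toNat

/-- The passage from `n` to the Gödel number of `ofNat n` is primitive recursive. -/
theorem primrec_toNat_ofNat (P : Type v) [Primcodable P] :
    Primrec fun n => (ofNat (P := P) n).map toNat := by
  let g : Unit → List (Option ℕ) → Option (Option ℕ) := fun _ l =>
    some (l.length.casesOn (some 0) fun n =>
      if n % 7 = 0 then
        (Encodable.decode (α := P) (n / 7)).map fun p => 7 * Encodable.encode p + 1
      else if n % 7 < 4 then (l.getD (n / 7) none).map fun a => 7 * a + (n % 7 + 1)
      else (l.getD (n / 7).unpair.1 none).bind fun a =>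
        (l.getD (n / 7).unpair.2 none).map fun b => 7 * Nat.pair a b + (n % 7 + 1))
  have hg : Primrec₂ g := by
    have hl : Primrec fun q : (Unit × List (Option ℕ)) × ℕ => q.1.2 :=
      Primrec.snd.comp Primrec.fst
    have hd : Primrec fun q : (Unit × List (Option ℕ)) × ℕ => q.2 / 7 :=
      Primrec.nat_div.comp Primrec.snd (Primrec.const 7)
    have hm : Primrec fun q : (Unit × List (Option ℕ)) × ℕ => q.2 % 7 :=
      Primrec.nat_mod.comp Primrec.snd (Primrec.const 7)
    have hx : ∀ {h : (Unit × List (Option ℕ)) × ℕ → ℕ}, Primrec h →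
        Primrec fun q : (Unit × List (Option ℕ)) × ℕ => q.1.2.getD (h q) none :=
      fun hh => (Primrec.list_getD none).comp hl hh
    have h7 : Primrec fun a : ℕ => 7 * a := Primrec.nat_mul.comp (Primrec.const 7) Primrec.id
    refine Primrec.option_some.comp (Primrec.nat_casesOn
      (Primrec.list_length.comp Primrec.snd) (Primrec.const _) ?_)
    refine Primrec.ite (Primrec.eq.comp hm (Primrec.const 0)) ?_
      (Primrec.ite (Primrec.nat_lt.comp hm (Primrec.const 4)) ?_ ?_)
    · exact Primrec.option_map (Primrec.decode.comp hd)
        (Primrec.succ.comp (h7.comp (Primrec.encode.comp Primrec.snd)))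
    · exact Primrec.option_map (hx hd)
        (Primrec.nat_add.comp (h7.comp Primrec.snd) (Primrec.succ.comp (hm.comp Primrec.fst)))
    · refine Primrec.option_bind (hx (Primrec.fst.comp (Primrec.unpair.comp hd))) ?_
      refine Primrec.option_map
        ((hx (Primrec.snd.comp (Primrec.unpair.comp hd))).comp Primrec.fst) ?_
      exact Primrec.nat_add.comp
        (h7.comp (Primrec₂.natPair.comp (Primrec.snd.comp Primrec.fst) Primrec.snd))
        (Primrec.succ.comp (hm.comp (Primrec.fst.comp Primrec.fst)))
  have key : Primrec₂ fun (_ : Unit) n => (ofNat (P := P) n).map toNat := by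
    refine Primrec.nat_strong_rec _ hg fun _ n => ?_
    cases n with
    | zero => simp [g, ofNat, toNat]
    | succ n =>
      have h0 : n / 7 < n + 1 := Nat.lt_succ_of_le (Nat.div_le_self n 7)
      have h1 : (n / 7).unpair.1 < n + 1 := (Nat.unpair_left_le _).trans_lt h0
      have h2 : (n / 7).unpair.2 < n + 1 := (Nat.unpair_right_le _).trans_lt h0
      have hr : n % 7 < 7 := Nat.mod_lt _ (by norm_num)
      simp only [g, List.length_map, List.length_range, List.getD_eq_getElem?_getD,
        List.getElem?_map, List.getElem?_range h0, List.getElem?_range h1,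
        List.getElem?_range h2, Option.map_some, Option.getD_some]
      rw [ofNat]
      generalize n / 7 = m at *
      generalize n % 7 = r at *
      congr 1
      interval_cases r <;> simp [Option.map_map, Function.comp_def, toNat] <;>
        cases ofNat (P := P) m.unpair.1 <;> cases ofNat (P := P) m.unpair.2 <;> simp
  exact key.comp (Primrec.const ()) Primrec.id

/-- The effective presentation of the set of formulas given by Gödel numbers. -/
instance {P : Type v} [Primcodable P] : Primcodable (Formula P) where
  prim := by
    refine Primrec.nat_iff.1 ((Primrec.encode.comp (primrec_toNat_ofNat P)).of_eq fun n => ?_)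
    change _ = Encodable.encode (ofNat (P := P) n)
    cases ofNat (P := P) n <;> rfl

end Formula

end ITL

/-! Validity is decided through a finite model property with a primitive recursive size bound.
Suppose a formula with Gödel number `c` fails in a model. Label each world by the codes up to `c` of
the formulas true there. Labels are monotone along the order, so a chain of worlds with changing
labels has bounded length. Hence finitely many types suffice to determine the label of a world and
the types occurring above it with another label (`exists_typing`).

Each type unfolds into a finite tree whose nodes are chains of types ordered by prefix. Representing
this tree by chains of worlds above some `w` and applying `S` gives a monotone map into the tree of
the type of `S w` (`Typing.exists_transition`). Repeated labels are dropped on the way, which keeps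
the trees of bounded height.

Types and such maps respect every local truth condition, but an arbitrary choice of maps may
postpone eventualities forever. From each node some path of maps does meet a given eventuality
(`Typing.exists_moves`), and finitely many are pending at once. Enlarging each position by an
agenda, a set of pending obligations to be emptied before it is refilled, yields one deterministic
successor function that meets them all (`exists_strategy`). Since the agenda is shared by the whole
tree, the function stays monotone. The resulting finite poset satisfies the truth conditions
(`Typing.exists_treeModel`, `isLabelling_of_simulation`).

Finite labelled structures are then coded by numbers and checking such a code is primitive
recursive, so non-validity is a bounded search (`not_valid_iff`). A formula is satisfiable exactly
when its negation is not valid. -/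

namespace ITL

/-! ### Finitely many types of labelled worlds. -/

section Types

variable {W : Type u} [Preorder W] (ℓ : W → Finset ℕ)

/-- `v` lies above `w` and carries a different label. -/
def Above (w v : W) : Prop := w ≤ v ∧ ℓ v ≠ ℓ w

/-- A bound for the number of types of a given level over labels contained in `range s`. -/
def typeBound (s : ℕ) : ℕ → ℕ
  | 0 => 2 ^ s
  | n + 1 => 2 ^ s * 2 ^ typeBound s n

/-- The number with a given set of bit indices. -/
def bitCode (A : Finset ℕ) : ℕ := ∑ i ∈ A, 2 ^ i

theorem bitCode_lt {m : ℕ} {A : Finset ℕ} (h : A ⊆ Finset.range m) : bitCode A < 2 ^ m :=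
  Nat.geomSum_lt le_rfl fun _ hk => Finset.mem_range.1 (h hk)

theorem bitCode_injective : Function.Injective bitCode :=
  Finset.equivBitIndices.symm.injective

open Classical in
/-- The type of level `n` of a world: its label together with the types of level `n - 1` of the
worlds above it with a different label. -/
noncomputable def levelType (s : ℕ) : ℕ → W → ℕ
  | 0, w => bitCode (ℓ w)
  | n + 1, w => bitCode (ℓ w) + 2 ^ s *
      bitCode ((Finset.range (typeBound s n)).filter fun t => ∃ v, Above ℓ w v ∧ levelType s n v = t)

variable {ℓ} {s : ℕ}

open Classical in
theorem levelType_lt (hs : ∀ w, ℓ w ⊆ Finset.range s) (n : ℕ) (w : W) :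
    levelType ℓ s n w < typeBound s n := by
  cases n with
  | zero => exact bitCode_lt (hs w)
  | succ n =>
    rw [levelType, typeBound]
    have h1 := bitCode_lt (hs w)
    have h2 := bitCode_lt (Finset.filter_subset
      (fun t => ∃ v, Above ℓ w v ∧ levelType ℓ s n v = t) (Finset.range (typeBound s n)))
    calc _ < 2 ^ s + 2 ^ s * _ := Nat.add_lt_add_right h1 _
      _ = 2 ^ s * (_ + 1) := by ring
      _ ≤ _ := Nat.mul_le_mul_left _ h2

theorem levelType_succ_eq_iff (hs : ∀ w, ℓ w ⊆ Finset.range s) (n : ℕ) (w w' : W) :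
    levelType ℓ s (n + 1) w = levelType ℓ s (n + 1) w' ↔ ℓ w = ℓ w' ∧
      ∀ t, (∃ v, Above ℓ w v ∧ levelType ℓ s n v = t) ↔
        ∃ v, Above ℓ w' v ∧ levelType ℓ s n v = t := by
  constructor
  · intro h
    simp only [levelType] at h
    -- The code of a label is below `2 ^ s`, so residue and quotient recover the two components.
    have h0 := congrArg (· % 2 ^ s) h
    have h1 := congrArg (· / 2 ^ s) h
    simp only [Nat.add_mul_mod_self_left, Nat.mod_eq_of_lt (bitCode_lt (hs _))] at h0
    simp only [Nat.add_mul_div_left _ _ (Nat.two_pow_pos s),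
      Nat.div_eq_of_lt (bitCode_lt (hs _)), zero_add] at h1
    refine ⟨bitCode_injective h0, fun t => ?_⟩
    have h2 := Finset.ext_iff.1 (bitCode_injective h1) t
    simp only [Finset.mem_filter, Finset.mem_range] at h2
    constructor
    · rintro ⟨v, hv, rfl⟩
      exact (h2.1 ⟨levelType_lt hs n v, v, hv, rfl⟩).2
    · rintro ⟨v, hv, rfl⟩
      exact (h2.2 ⟨levelType_lt hs n v, v, hv, rfl⟩).2
  · rintro ⟨h1, h2⟩
    simp only [levelType, h1]
    congr 3
    ext t
    simp only [Finset.mem_filter, h2]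

theorem label_eq_of_levelType_eq (hs : ∀ w, ℓ w ⊆ Finset.range s) {n : ℕ} {w w' : W}
    (h : levelType ℓ s n w = levelType ℓ s n w') : ℓ w = ℓ w' := by
  cases n with
  | zero => exact bitCode_injective h
  | succ n => exact ((levelType_succ_eq_iff hs n w w').1 h).1

theorem card_lt_of_above (hm : Monotone ℓ) {w v : W} (h : Above ℓ w v) :
    (ℓ w).card < (ℓ v).card :=
  Finset.card_lt_card ((hm h.1).lt_of_ne h.2.symm)

theorem card_label_le {α : Type*} {ℓ : α → Finset ℕ} (hs : ∀ w, ℓ w ⊆ Finset.range s) (w : α) :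
    (ℓ w).card ≤ s := by
  simpa using Finset.card_le_card (hs w)

/-- Each step to a different label enlarges the label, so at most `s - (ℓ w).card` such steps start
at `w`. A type whose level is at least that number already sees everything, and deeper levels add
nothing. -/
theorem levelType_stable (hm : Monotone ℓ) (hs : ∀ w, ℓ w ⊆ Finset.range s) (n : ℕ) :
    ∀ w w' : W, s ≤ n + (ℓ w).card → levelType ℓ s n w = levelType ℓ s n w' →
      ∀ m, levelType ℓ s m w = levelType ℓ s m w' := by
  induction n with
  | zero =>
    intro w w' hw h m
    have hl := label_eq_of_levelType_eq hs h
    cases m with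
    | zero => exact h
    | succ m =>
      refine (levelType_succ_eq_iff hs m w w').2 ⟨hl, fun t => ⟨?_, ?_⟩⟩
      · rintro ⟨v, hv, -⟩
        have := card_lt_of_above hm hv
        have := card_label_le hs v
        omega
      · rintro ⟨v, hv, -⟩
        have := card_lt_of_above hm hv
        have := card_label_le hs v
        rw [hl] at hw
        omega
  | succ n ih =>
    intro w w' hw h m
    obtain ⟨hl, hv⟩ := (levelType_succ_eq_iff hs n w w').1 h
    cases m with
    | zero => simp only [levelType, hl]
    | succ m =>
      refine (levelType_succ_eq_iff hs m w w').2 ⟨hl, fun t => ⟨?_, ?_⟩⟩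
      · rintro ⟨v, hwv, rfl⟩
        obtain ⟨v', hv', he⟩ := (hv _).1 ⟨v, hwv, rfl⟩
        have := card_lt_of_above hm hwv
        exact ⟨v', hv', (ih v v' (by omega) he.symm m).symm⟩
      · rintro ⟨v, hwv, rfl⟩
        obtain ⟨v', hv', he⟩ := (hv _).2 ⟨v, hwv, rfl⟩
        have := card_lt_of_above hm hwv
        rw [hl] at hw
        exact ⟨v', hv', (ih v v' (by omega) he.symm m).symm⟩

/-- Finitely many types suffice to determine the label of a world and the types of the worlds
above it with a different label. -/
theorem exists_typing (hm : Monotone ℓ) (hs : ∀ w, ℓ w ⊆ Finset.range s) :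
    ∃ σ : W → Fin (typeBound s s), (∀ w w', σ w = σ w' → ℓ w = ℓ w') ∧
      ∀ w w' v, σ w = σ w' → Above ℓ w v → ∃ v', Above ℓ w' v' ∧ σ v' = σ v := by
  refine ⟨fun w => ⟨levelType ℓ s s w, levelType_lt hs s w⟩, fun w w' h => ?_,
    fun w w' v h hv => ?_⟩
  · exact label_eq_of_levelType_eq hs (Fin.mk.inj_iff.1 h)
  -- Equality at level `s` gives equality at level `s + 1`, which in turn matches worlds above by
  -- their types of the same level `s`.
  · have h1 := levelType_stable hm hs s w w' (Nat.le_add_right _ _) (Fin.mk.inj_iff.1 h) (s + 1)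
    obtain ⟨v', hv', he⟩ := (((levelType_succ_eq_iff hs s w w').1 h1).2 _).1 ⟨v, hv, rfl⟩
    exact ⟨v', hv', Fin.ext he⟩

end Types

/-- The last element of the nonempty list `x :: l`. -/
def tip {α : Type*} : α → List α → α
  | x, [] => x
  | _, y :: l => tip y l

theorem tip_map {α β : Type*} (f : α → β) (x : α) (l : List α) :
    tip (f x) (l.map f) = f (tip x l) := by
  induction l generalizing x with
  | nil => rfl
  | cons y l ih => exact ih y

theorem tip_append {α : Type*} (x : α) (l l' : List α) :
    tip x (l ++ l') = tip (tip x l) l' := by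
  induction l generalizing x with
  | nil => rfl
  | cons y l ih => exact ih y

/-- One step of a transition system whose transitions act on a set of points. -/
def Moves {K X : Type*} (Tr : K → K → (X → X) → Prop) (p p' : K × X) : Prop :=
  ∃ g, Tr p.1 p'.1 g ∧ g p.2 = p'.2

/-! ### Applying the successor function to chains. -/

section Push

variable {W : Type u} {Q : Type*} {S : W → W} {ℓ : W → Finset ℕ}

/-- The image under `S` of a chain, where worlds whose label repeats are dropped. -/
def push (S : W → W) (ℓ : W → Finset ℕ) : W → List W → List W
  | _, [] => []
  | u, v :: l => if ℓ (S v) = ℓ u then push S ℓ u l else S v :: push S ℓ (S v) l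

/-- A world is dropped only if its label equals that of the last world kept, so the final label
survives even when the final world does not. -/
theorem label_tip_push {w u : W} {l : List W} (hu : ℓ u = ℓ (S w)) :
    ℓ (tip u (push S ℓ u l)) = ℓ (S (tip w l)) := by
  induction l generalizing w u with
  | nil => exact hu
  | cons v l ih =>
    rw [push]
    split_ifs with h
    · exact ih h.symm
    · exact ih rfl

theorem push_prefix {u : W} {l l' : List W} (h : l <+: l') :
    push S ℓ u l <+: push S ℓ u l' := by
  induction l generalizing u l' with
  | nil => exact List.nil_prefix
  | cons v l ih =>
    obtain ⟨t, rfl⟩ := h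
    simp only [List.cons_append, push]
    split_ifs
    · exact ih (List.prefix_append _ _)
    · exact (List.prefix_cons_inj _).2 (ih (List.prefix_append _ _))

theorem length_push_le (u : W) (l : List W) : (push S ℓ u l).length ≤ l.length := by
  induction l generalizing u with
  | nil => exact le_rfl
  | cons v l ih =>
    rw [push]
    split_ifs
    · exact (ih u).trans (Nat.le_succ _)
    · exact Nat.succ_le_succ (ih _)

/-- The tip can leave its `S`-orbit only if something was dropped. This is the termination measure
for tracking eventualities. -/
theorem tip_push_or (w : W) (l : List W) :
    tip (S w) (push S ℓ (S w) l) = S (tip w l) ∨ (push S ℓ (S w) l).length < l.length := by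
  induction l generalizing w with
  | nil => exact Or.inl rfl
  | cons v l ih =>
    rw [push]
    split_ifs
    · exact Or.inr (Nat.lt_succ_of_le (length_push_le _ _))
    · exact (ih v).imp id Nat.succ_lt_succ

/-- The chain obtained from a list of types by picking worlds one after the other. -/
def pickChain (pick : W → Q → W) : W → List Q → List W
  | _, [] => []
  | w, c :: a => pick w c :: pickChain pick (pick w c) a

theorem pickChain_prefix (pick : W → Q → W) {w : W} {a b : List Q} (h : a <+: b) :
    pickChain pick w a <+: pickChain pick w b := by
  induction a generalizing w b with
  | nil => exact List.nil_prefix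
  | cons c a ih =>
    obtain ⟨t, rfl⟩ := h
    exact (List.prefix_cons_inj _).2 (ih (List.prefix_append _ _))

end Push

/-! ### Trees of types and the maps between them. -/

section Trees

variable {W : Type u} [Preorder W] {Q : Type*}

/-- A typing of the worlds of a labelled dynamic preorder: the type of a world determines its label
and the types of the worlds above it with a different label. -/
structure Typing (S : W → W) (ℓ : W → Finset ℕ) (σ : W → Q) (lab : Q → Finset ℕ) : Prop where
  monotone_map : Monotone S
  monotone_label : Monotone ℓ
  lab_eq : ∀ w, lab (σ w) = ℓ w
  lift : ∀ w w' v, σ w = σ w' → Above ℓ w v → ∃ v', Above ℓ w' v' ∧ σ v' = σ v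

/-- Chains of worlds with growing labels that start above `w`. -/
def WorldChain (ℓ : W → Finset ℕ) (w : W) (l : List W) : Prop := (w :: l).IsChain (Above ℓ)

/-- The type `c` occurs above the type `q`. -/
def Covers (ℓ : W → Finset ℕ) (σ : W → Q) (q c : Q) : Prop :=
  ∃ w v, Above ℓ w v ∧ σ w = q ∧ σ v = c

/-- The nodes of the tree of the type `q`, ordered by the prefix relation. -/
def Node (ℓ : W → Finset ℕ) (σ : W → Q) (q : Q) (a : List Q) : Prop :=
  (q :: a).IsChain (Covers ℓ σ)

/-- The maps between the trees of two types that are compatible with the dynamics. -/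
structure Transition (S : W → W) (ℓ : W → Finset ℕ) (σ : W → Q) (lab : Q → Finset ℕ)
    (q q' : Q) (g : List Q → List Q) : Prop where
  node : ∀ a, Node ℓ σ q a → Node ℓ σ q' (g a)
  mono : ∀ a b, a <+: b → g a <+: g b
  label : ∀ a, Node ℓ σ q a → ∃ v, ℓ v = lab (tip q a) ∧ ℓ (S v) = lab (tip q' (g a))

/-- The transitions between the types of worlds. -/
def TypeTransition (S : W → W) (ℓ : W → Finset ℕ) (σ : W → Q) (lab : Q → Finset ℕ)
    (q q' : Set.range σ) (g : List Q → List Q) : Prop :=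
  Transition S ℓ σ lab q q' g

variable {S : W → W} {ℓ : W → Finset ℕ} {σ : W → Q} {lab : Q → Finset ℕ}

theorem push_chain (hS : Monotone S) {w u : W} {l : List W} (hu : u ≤ S w)
    (hl : WorldChain ℓ w l) : WorldChain ℓ u (push S ℓ u l) := by
  induction l generalizing w u with
  | nil => exact List.IsChain.singleton u
  | cons v l ih =>
    obtain ⟨h1, h2⟩ := List.isChain_cons_cons.1 hl
    have huv : u ≤ S v := hu.trans (hS h1.1)
    rw [push]
    split_ifs with h
    · exact ih huv h2
    · exact List.isChain_cons_cons.2 ⟨⟨huv, h⟩, ih le_rfl h2⟩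

theorem node_map {w : W} {l : List W} (h : WorldChain ℓ w l) : Node ℓ σ (σ w) (l.map σ) := by
  induction l generalizing w with
  | nil => exact List.IsChain.singleton _
  | cons v l ih =>
    obtain ⟨h1, h2⟩ := List.isChain_cons_cons.1 h
    exact List.isChain_cons_cons.2 ⟨⟨w, v, h1, rfl, rfl⟩, ih h2⟩

namespace Typing

theorem exists_above (T : Typing S ℓ σ lab) {w : W} {c : Q} (h : Covers ℓ σ (σ w) c) :
    ∃ v, Above ℓ w v ∧ σ v = c := by
  obtain ⟨w', v', h1, h2, rfl⟩ := h
  exact T.lift _ _ _ h2 h1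

theorem exists_pick (T : Typing S ℓ σ lab) :
    ∃ pick : W → Q → W, ∀ w c, Covers ℓ σ (σ w) c → Above ℓ w (pick w c) ∧ σ (pick w c) = c := by
  classical
  refine ⟨fun w c => if h : Covers ℓ σ (σ w) c then (T.exists_above h).choose else w,
    fun w c h => ?_⟩
  simp only [dif_pos h]
  exact (T.exists_above h).choose_spec

/-- The nodes of the tree of the type of `w` can be represented coherently by chains of worlds
above `w`, with a prescribed chain among the representatives. -/
theorem exists_chains (T : Typing S ℓ σ lab) {w : W} {l : List W} (hl : WorldChain ℓ w l) :
    ∃ ρ : List Q → List W,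
      (∀ a, Node ℓ σ (σ w) a → WorldChain ℓ w (ρ a) ∧ (ρ a).map σ = a) ∧
      (∀ a b, a <+: b → ρ a <+: ρ b) ∧ ρ (l.map σ) = l := by
  classical
  obtain ⟨pick, hpick⟩ := T.exists_pick
  have key : ∀ a w, Node ℓ σ (σ w) a →
      WorldChain ℓ w (pickChain pick w a) ∧ (pickChain pick w a).map σ = a := by
    intro a
    induction a with
    | nil => exact fun w _ => ⟨List.IsChain.singleton _, rfl⟩
    | cons c a ih =>
      intro w h
      obtain ⟨h1, h2⟩ := List.isChain_cons_cons.1 h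
      obtain ⟨h3, h4⟩ := hpick w c h1
      obtain ⟨h5, h6⟩ := ih (pick w c) (by rw [h4]; exact h2)
      exact ⟨List.isChain_cons_cons.2 ⟨h3, h5⟩, by rw [pickChain, List.map_cons, h4, h6]⟩
  induction l generalizing w with
  | nil => exact ⟨pickChain pick w, fun a => key a w, fun _ _ => pickChain_prefix pick, rfl⟩
  | cons v l ih =>
    obtain ⟨h1, h2⟩ := List.isChain_cons_cons.1 hl
    obtain ⟨ρ, h3, h4, h5⟩ := ih h2
    -- The branch that starts with the type of `v` must pass through `v` itself; all other branches
    -- are filled by `pick`. The first type alone decides, so prefixes are preserved.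
    refine ⟨fun a => match a with
      | [] => []
      | c :: a => if c = σ v then v :: ρ a else pickChain pick w (c :: a), ?_, ?_, ?_⟩
    · rintro (_ | ⟨c, a⟩) h
      · exact ⟨List.IsChain.singleton _, rfl⟩
      · dsimp only
        split_ifs with hc
        · subst hc
          obtain ⟨h6, h7⟩ := h3 a (List.isChain_cons_cons.1 h).2
          exact ⟨List.isChain_cons_cons.2 ⟨h1, h6⟩, by rw [List.map_cons, h7]⟩
        · exact key _ _ h
    · rintro (_ | ⟨c, a⟩) b ⟨t, rfl⟩
      · exact List.nil_prefix
      · dsimp only [List.cons_append]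
        split_ifs with hc
        · exact (List.prefix_cons_inj _).2 (h4 _ _ (List.prefix_append _ _))
        · exact pickChain_prefix pick (List.prefix_append (c :: a) t)
    · simp [h5]

/-- The map is "represent by worlds, push along `S`, take types". Choosing representatives that
include `l` makes the map follow the actual image of `l`. -/
theorem exists_transition (T : Typing S ℓ σ lab) {w : W} {l : List W} (hl : WorldChain ℓ w l) :
    ∃ g, Transition S ℓ σ lab (σ w) (σ (S w)) g ∧
      g (l.map σ) = (push S ℓ (S w) l).map σ := by
  obtain ⟨ρ, h1, h2, h3⟩ := T.exists_chains hl
  refine ⟨fun a => (push S ℓ (S w) (ρ a)).map σ, ⟨fun a ha => ?_, fun a b h => ?_, fun a ha => ?_⟩,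
    by simp only [h3]⟩
  · exact node_map (push_chain T.monotone_map le_rfl (h1 a ha).1)
  · exact (push_prefix (h2 a b h)).map σ
  · refine ⟨tip w (ρ a), ?_, ?_⟩
    · rw [← T.lab_eq, ← tip_map σ, (h1 a ha).2]
    · rw [tip_map, T.lab_eq]
      exact (label_tip_push (w := w) rfl).symm

/-- Follow the orbit of the chain under `push`. While no entry is dropped, the tip runs along its
`S`-orbit towards a good label. If an entry is dropped, the tip may change, so the search restarts
with a shorter chain. -/
theorem exists_moves_chain (T : Typing S ℓ σ lab) {good : Finset ℕ → Prop}
    (hg : ∀ v, ∃ k : ℕ, good (ℓ (S^[k] v))) {w : W} {l : List W} (hl : WorldChain ℓ w l) :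
    ∃ p, Relation.ReflTransGen (Moves (TypeTransition S ℓ σ lab)) (⟨σ w, w, rfl⟩, l.map σ) p ∧ good (lab (tip p.1.1 p.2)) := by
  obtain ⟨k, hk⟩ := hg (tip w l)
  induction hn : l.length using Nat.strong_induction_on generalizing w l k with
  | _ n ihn =>
  induction k generalizing w l with
  | zero =>
    refine ⟨_, .refl, ?_⟩
    dsimp only
    rw [tip_map, T.lab_eq]
    exact hk
  | succ k ihk =>
    obtain ⟨g, h1, h2⟩ := T.exists_transition hl
    have hp := push_chain T.monotone_map (le_refl (S w)) hl
    have hm : Moves (TypeTransition S ℓ σ lab) (⟨σ w, w, rfl⟩, l.map σ) (⟨σ (S w), S w, rfl⟩, (push S ℓ (S w) l).map σ) :=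
      ⟨g, h1, h2⟩
    suffices h : ∃ p, Relation.ReflTransGen (Moves (TypeTransition S ℓ σ lab))
        (⟨σ (S w), S w, rfl⟩, (push S ℓ (S w) l).map σ) p ∧ good (lab (tip p.1.1 p.2)) by
      obtain ⟨p, h3, h4⟩ := h
      exact ⟨p, .head hm h3, h4⟩
    by_cases hlt : (push S ℓ (S w) l).length < n
    -- The new tip has its own waiting time, possibly larger than `k`; the outer induction on the
    -- length absorbs this.
    · obtain ⟨k', hk'⟩ := hg (tip (S w) (push S ℓ (S w) l))
      exact ihn _ hlt hp k' hk' rfl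
    · have h3 := (tip_push_or (S := S) (ℓ := ℓ) w l).resolve_right (by omega)
      refine ihk hp (by rw [h3]; exact hk) ?_
      have := length_push_le (S := S) (ℓ := ℓ) (S w) l
      omega

theorem exists_moves (T : Typing S ℓ σ lab) {good : Finset ℕ → Prop}
    (hg : ∀ v, ∃ k : ℕ, good (ℓ (S^[k] v))) {q : Set.range σ} {a : List Q}
    (ha : Node ℓ σ q a) :
    ∃ p, Relation.ReflTransGen (Moves (TypeTransition S ℓ σ lab)) (q, a) p ∧ good (lab (tip p.1.1 p.2)) := by
  obtain ⟨_, w, rfl⟩ := q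
  obtain ⟨ρ, h1, -⟩ := T.exists_chains (List.IsChain.singleton w)
  obtain ⟨h2, h3⟩ := h1 a ha
  have := T.exists_moves_chain hg h2
  rwa [h3] at this

end Typing

end Trees

/-! ### A deterministic strategy that meets all obligations. -/

section Strategy

variable {K X ι : Type*} {Tr : K → K → (X → X) → Prop} {pend : K → X → ι → Prop}

/-- A position together with a set of pending obligations. -/
structure Agenda (pend : K → X → ι → Prop) where
  pos : K
  todo : Set (X × ι)
  pending : ∀ p ∈ todo, pend pos p.1 p.2

namespace Agenda

/-- The obligations that are still pending after a transition. -/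
def next (A : Agenda pend) (k : K) (g : X → X) : Agenda pend where
  pos := k
  todo := {p | pend k p.1 p.2 ∧ p ∈ Prod.map g id '' A.todo}
  pending := fun _ hp => hp.1

/-- The agenda of all pending obligations. -/
def full (pend : K → X → ι → Prop) (k : K) : Agenda pend where
  pos := k
  todo := {p | pend k p.1 p.2}
  pending := fun _ hp => hp

/-- One step of the transition system on agendas. -/
def Step (Tr : K → K → (X → X) → Prop) (A B : Agenda pend) : Prop :=
  ∃ g, Tr A.pos B.pos g ∧ B = A.next B.pos g

theorem finite_todo (hfin : ∀ k, {p : X × ι | pend k p.1 p.2}.Finite) (A : Agenda pend) :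
    A.todo.Finite :=
  (hfin A.pos).subset A.pending

theorem ncard_next_le (hfin : ∀ k, {p : X × ι | pend k p.1 p.2}.Finite) (A : Agenda pend)
    (k : K) (g : X → X) : (A.next k g).todo.ncard ≤ A.todo.ncard :=
  (Set.ncard_le_ncard (fun _ hp => hp.2) ((A.finite_todo hfin).image _)).trans
    (Set.ncard_image_le (A.finite_todo hfin))

/-- Let the agenda follow the given path. A transition never enlarges the agenda, and the tracked
obligation must leave it at the latest when `p'` is reached; at that moment it becomes strictly
smaller. -/
theorem exists_ncard_lt (hfin : ∀ k, {p : X × ι | pend k p.1 p.2}.Finite) {r : ι}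
    {p p' : K × X} (h : Relation.ReflTransGen (Moves Tr) p p') (hp' : ¬ pend p'.1 p'.2 r)
    (A : Agenda pend) (hA : A.pos = p.1) (hr : (p.2, r) ∈ A.todo) :
    ∃ B, Relation.ReflTransGen (Step Tr) A B ∧ B.todo.ncard < A.todo.ncard := by
  induction h using Relation.ReflTransGen.head_induction_on generalizing A with
  | refl => exact absurd (hA ▸ A.pending _ hr) hp'
  | @head p p₁ h1 _ ih =>
    obtain ⟨g, hg, hx⟩ := h1
    have hstep : Step Tr A (A.next p₁.1 g) := ⟨g, hA ▸ hg, rfl⟩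
    have hle := A.ncard_next_le hfin p₁.1 g
    by_cases hmem : (p₁.2, r) ∈ (A.next p₁.1 g).todo
    · obtain ⟨B, h2, h3⟩ := ih (A.next p₁.1 g) rfl hmem
      exact ⟨B, .head hstep h2, h3.trans_le hle⟩
    · refine ⟨_, .single hstep, ?_⟩
      have hss : (A.next p₁.1 g).todo ⊂ Prod.map g id '' A.todo :=
        (Set.ssubset_iff_of_subset fun _ hp => And.right hp).2
          ⟨(p₁.2, r), ⟨(p.2, r), hr, by rw [← hx]; rfl⟩, hmem⟩
      exact (Set.ncard_lt_ncard hss ((A.finite_todo hfin).image _)).trans_le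
        (Set.ncard_image_le (A.finite_todo hfin))

theorem exists_todo_empty (hfin : ∀ k, {p : X × ι | pend k p.1 p.2}.Finite)
    (hreach : ∀ k x r, pend k x r →
      ∃ p, Relation.ReflTransGen (Moves Tr) (k, x) p ∧ ¬ pend p.1 p.2 r) (A : Agenda pend) :
    ∃ B, Relation.ReflTransGen (Step Tr) A B ∧ B.todo = ∅ := by
  induction hn : A.todo.ncard using Nat.strong_induction_on generalizing A with
  | _ n ih =>
  rcases A.todo.eq_empty_or_nonempty with h | ⟨⟨x, r⟩, h⟩
  · exact ⟨A, .refl, h⟩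
  · obtain ⟨p, h1, h2⟩ := hreach _ _ _ (A.pending _ h)
    obtain ⟨B, h3, h4⟩ := A.exists_ncard_lt hfin h1 h2 rfl h
    obtain ⟨C, h5, h6⟩ := ih _ (hn ▸ h4) B rfl
    exact ⟨C, h3.trans h5, h6⟩

end Agenda

/-- The rank is the least number of steps to `Z`. It turns the existence of paths into a positional
choice that makes progress. -/
theorem exists_rank {α : Type*} {r : α → α → Prop} {Z : α → Prop}
    (h : ∀ a, ∃ b, Relation.ReflTransGen r a b ∧ Z b) :
    ∃ d : α → ℕ, ∀ a, ¬ Z a → ∃ b, r a b ∧ d b < d a := by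
  classical
  let N : ℕ → α → Prop := fun n => Nat.rec (motive := fun _ => α → Prop) Z (fun _ p a => ∃ b, r a b ∧ p b) n
  have hN : ∀ a, ∃ n, N n a := by
    intro a
    obtain ⟨b, hab, hb⟩ := h a
    induction hab using Relation.ReflTransGen.head_induction_on with
    | refl => exact ⟨0, hb⟩
    | head h1 _ ih => exact ih.elim fun n hn => ⟨n + 1, _, h1, hn⟩
  refine ⟨fun a => Nat.find (hN a), fun a ha => ?_⟩
  have hs := Nat.find_spec (hN a)
  generalize hn : Nat.find (hN a) = n at hs
  cases n with
  | zero => exact absurd hs ha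
  | succ n =>
    obtain ⟨b, h1, h2⟩ := hs
    refine ⟨b, h1, ?_⟩
    simp only [hn]
    exact Nat.lt_succ_of_le (Nat.find_min' _ h2)

/-- If every obligation can be met along some path, then a strategy on agendas meets all of them. -/
theorem exists_strategy (hfin : ∀ k, {p : X × ι | pend k p.1 p.2}.Finite)
    (hreach : ∀ k x r, pend k x r →
      ∃ p, Relation.ReflTransGen (Moves Tr) (k, x) p ∧ ¬ pend p.1 p.2 r)
    (hserial : ∀ k, ∃ k' g, Tr k k' g) :
    ∃ (F : Agenda pend → Agenda pend) (g : Agenda pend → X → X),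
      (∀ A, Tr A.pos (F A).pos (g A)) ∧
      ∀ (A : Agenda pend) x r, ∃ n : ℕ,
        ¬ pend (((fun p : Agenda pend × X => (F p.1, g p.1 p.2))^[n] (A, x)).1.pos)
          (((fun p : Agenda pend × X => (F p.1, g p.1 p.2))^[n] (A, x)).2) r := by
  classical
  obtain ⟨d, hd⟩ := exists_rank (Agenda.exists_todo_empty hfin hreach)
  have hstep : ∀ A : Agenda pend, ∃ (B : Agenda pend) (g : X → X), Tr A.pos B.pos g ∧
      (A.todo = ∅ → B = (Agenda.full pend A.pos).next B.pos g) ∧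
      (A.todo ≠ ∅ → B = A.next B.pos g ∧ d B < d A) := by
    intro A
    by_cases hA : A.todo = ∅
    · obtain ⟨k, g, hg⟩ := hserial A.pos
      -- An empty agenda moves as though it had just been refilled with everything pending.
      exact ⟨(Agenda.full pend A.pos).next k g, g, hg, fun _ => rfl, fun h => absurd hA h⟩
    · obtain ⟨B, ⟨g, h1, h2⟩, h3⟩ := hd A hA
      exact ⟨B, g, h1, fun h => absurd h hA, fun _ => ⟨h2, h3⟩⟩
  choose F g h1 h2 h3 using hstep
  refine ⟨F, g, h1, fun A x r => ?_⟩
  by_contra! hpend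
  have hempty : ∀ (A : Agenda pend) (x : X), ∃ n : ℕ,
      ((fun p : Agenda pend × X => (F p.1, g p.1 p.2))^[n] (A, x)).1.todo = ∅ := by
    intro A x
    induction hn : d A using Nat.strong_induction_on generalizing A x with
    | _ n ih =>
    by_cases hA : A.todo = ∅
    · exact ⟨0, hA⟩
    · obtain ⟨m, hm⟩ := ih _ (hn ▸ (h3 A hA).2) (F A) (g A x) rfl
      exact ⟨m + 1, hm⟩
  have hmem : ∀ (A : Agenda pend) (x : X), (x, r) ∈ A.todo →
      (∀ n : ℕ, pend (((fun p : Agenda pend × X => (F p.1, g p.1 p.2))^[n] (A, x)).1.pos)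
        (((fun p : Agenda pend × X => (F p.1, g p.1 p.2))^[n] (A, x)).2) r) →
      ∀ n : ℕ, ((fun p : Agenda pend × X => (F p.1, g p.1 p.2))^[n] (A, x)).1.todo ≠ ∅ := by
    intro A x hx hp n
    induction n generalizing A x with
    | zero => exact Set.nonempty_iff_ne_empty.1 ⟨_, hx⟩
    | succ n ih =>
      refine ih (F A) (g A x) ?_ fun n => hp (n + 1)
      rw [(h3 A (Set.nonempty_iff_ne_empty.1 ⟨_, hx⟩)).1]
      exact ⟨hp 1, (x, r), hx, rfl⟩
  -- An obligation that is pending forever enters the agenda at the first refill and can never leave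
  -- it, yet the agenda must become empty again.
  obtain ⟨m, hm⟩ := hempty A x
  generalize hB : (fun p : Agenda pend × X => (F p.1, g p.1 p.2))^[m] (A, x) = B at hm
  have hB' : ∀ n : ℕ,
      pend (((fun p : Agenda pend × X => (F p.1, g p.1 p.2))^[n] B).1.pos)
        (((fun p : Agenda pend × X => (F p.1, g p.1 p.2))^[n] B).2) r := by
    intro n
    rw [← hB, ← Function.iterate_add_apply]
    exact hpend _
  obtain ⟨B, y⟩ := B
  obtain ⟨n, hn⟩ := hempty (F B) (g B y)
  refine hmem (F B) (g B y) ?_ (fun n => hB' (n + 1)) n hn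
  rw [h2 B hm]
  exact ⟨hB' 1, (y, r), hB' 0, rfl⟩

end Strategy

/-! ### Labels by Gödel numbers and the truth conditions. -/

section Labelling

variable {P : Type v}

theorem Model.monotone_map (M : Model.{u} P) : Monotone M.S := fun w v h => M.confluent w v h

theorem Sat.mono {M : Model.{u} P} {φ : Formula P} {w v : M.W} (hwv : w ≤ v) (h : Sat M w φ) :
    Sat M v φ := by
  induction φ generalizing w v with
  | var p => exact M.monotone w v hwv h
  | bot => exact h
  | and φ ψ ih₁ ih₂ => exact ⟨ih₁ hwv h.1, ih₂ hwv h.2⟩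
  | or φ ψ ih₁ ih₂ => exact h.imp (ih₁ hwv) (ih₂ hwv)
  | imp φ ψ _ _ => exact fun u hu => h u (hwv.trans hu)
  | next φ ih => exact ih (M.confluent w v hwv) h
  | diamond φ ih => exact h.imp fun k hk => ih (M.monotone_map.iterate k hwv) hk
  | box φ ih => exact fun k => ih (M.monotone_map.iterate k hwv) (h k)

variable [Encodable P]

theorem Formula.toNat_injective : Function.Injective (Formula.toNat : Formula P → ℕ) :=
  Encodable.encode_injective

variable (P) in
/-- The Gödel numbers of formulas. -/
def IsCode (n : ℕ) : Prop := ∃ φ : Formula P, φ.toNat = n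

open Classical in
/-- The set of the Gödel numbers up to `c` of the formulas that hold at a world. -/
noncomputable def label (M : Model.{u} P) (c : ℕ) (w : M.W) : Finset ℕ :=
  (Finset.range (c + 1)).filter fun n => ∃ φ : Formula P, φ.toNat = n ∧ Sat M w φ

section Label

variable {M : Model.{u} P} {c : ℕ}

open Classical in
theorem label_subset (w : M.W) : label M c w ⊆ Finset.range (c + 1) := Finset.filter_subset _ _

open Classical in
theorem toNat_mem_label {w : M.W} {φ : Formula P} (hφ : φ.toNat ≤ c) :
    φ.toNat ∈ label M c w ↔ Sat M w φ := by
  simp only [label, Finset.mem_filter, Finset.mem_range, Nat.lt_succ_of_le hφ, true_and]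
  exact ⟨fun ⟨ψ, h1, h2⟩ => Formula.toNat_injective h1 ▸ h2, fun h => ⟨φ, rfl, h⟩⟩

open Classical in
theorem isCode_of_mem_label {w : M.W} {n : ℕ} (h : n ∈ label M c w) : IsCode P n := by
  obtain ⟨φ, h1, -⟩ := (Finset.mem_filter.1 h).2
  exact ⟨φ, h1⟩

theorem label_monotone : Monotone (label M c) := by
  intro w v hwv n hn
  obtain ⟨φ, rfl⟩ := isCode_of_mem_label hn
  have hc : φ.toNat ≤ c := Nat.lt_succ_iff.1 (Finset.mem_range.1 (label_subset _ hn))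
  exact (toNat_mem_label hc).2 (((toNat_mem_label hc).1 hn).mono hwv)

end Label

/-- In a pending diamond the argument is missing from the label, so that it codes a formula has to
be read off the diamond. -/
theorem IsCode.of_diamond {m : ℕ} (h : IsCode P (7 * m + 3)) : IsCode P m := by
  obtain ⟨φ, h⟩ := h
  cases φ <;> simp only [Formula.toNat] at h <;> try omega
  next φ => exact ⟨φ, by omega⟩

/-- The eventuality with Gödel number `r` is not yet met at a world with label `L`. -/
def Pending (r : ℕ) (L : Finset ℕ) : Prop :=
  (∃ m, r = 7 * m + 3 ∧ r ∈ L ∧ m ∉ L) ∨ ∃ m, r = 7 * m + 4 ∧ r ∉ L ∧ m ∈ L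

/-- In a genuine model a true diamond is witnessed and a false box refuted after finitely many
steps; the obligation has lapsed by then. -/
theorem exists_not_pending (M : Model.{u} P) {c r : ℕ} (hr : r ≤ c) (w : M.W) :
    ∃ k : ℕ, ¬ Pending r (label M c (M.S^[k] w)) := by
  by_contra! h
  rcases h 0 with ⟨m, hm, h1, -⟩ | ⟨m, hm, h1, h2⟩
  · obtain ⟨φ, rfl⟩ : IsCode P m := (hm ▸ isCode_of_mem_label h1).of_diamond
    obtain ⟨k, hk⟩ := (toNat_mem_label (φ := φ.diamond) (hm ▸ hr)).1 (hm ▸ h1)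
    rcases h k with ⟨m', h3, -, h4⟩ | ⟨m', h3, -⟩
    · obtain rfl : m' = φ.toNat := by omega
      exact h4 ((toNat_mem_label (by omega)).2 hk)
    · omega
  · obtain ⟨φ, rfl⟩ := isCode_of_mem_label h2
    have hc : φ.box.toNat ≤ c := hm.symm.le.trans hr
    have h1' : φ.box.toNat ∉ label M c w := by rw [hm] at h1; exact h1
    refine h1' ((toNat_mem_label hc).2 fun k => ?_)
    rcases h k with ⟨m', h3, -⟩ | ⟨m', h3, -, h4⟩
    · omega
    · obtain rfl : m' = φ.toNat := by omega
      exact (toNat_mem_label (by omega)).1 h4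

variable (P) in
/-- `lab` is a labelling of a dynamic preorder by Gödel numbers that obeys the truth conditions of
all formulas with Gödel number at most `c`. -/
structure IsLabelling (c : ℕ) {W : Type*} [Preorder W] (S : W → W) (lab : W → ℕ → Prop) :
    Prop where
  monotone_map : Monotone S
  mono : ∀ w v n, n ≤ c → w ≤ v → lab w n → lab v n
  bot : ∀ w, ¬ lab w 0
  and : ∀ w a b, IsCode P a → IsCode P b → 7 * Nat.pair a b + 5 ≤ c →
    (lab w (7 * Nat.pair a b + 5) ↔ lab w a ∧ lab w b)
  or : ∀ w a b, IsCode P a → IsCode P b → 7 * Nat.pair a b + 6 ≤ c →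
    (lab w (7 * Nat.pair a b + 6) ↔ lab w a ∨ lab w b)
  imp : ∀ w a b, IsCode P a → IsCode P b → 7 * Nat.pair a b + 7 ≤ c →
    (lab w (7 * Nat.pair a b + 7) ↔ ∀ v, w ≤ v → lab v a → lab v b)
  next : ∀ w a, IsCode P a → 7 * a + 2 ≤ c → (lab w (7 * a + 2) ↔ lab (S w) a)
  diamond : ∀ w a, IsCode P a → 7 * a + 3 ≤ c → (lab w (7 * a + 3) ↔ ∃ k : ℕ, lab (S^[k] w) a)
  box : ∀ w a, IsCode P a → 7 * a + 4 ≤ c → (lab w (7 * a + 4) ↔ ∀ k : ℕ, lab (S^[k] w) a)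

/-- The model determined by a labelling. -/
def IsLabelling.model {c : ℕ} {W : Type u} [Nonempty W] [PartialOrder W] {S : W → W}
    {lab : W → ℕ → Prop} (h : IsLabelling P c S lab) : Model.{u} P where
  W := W
  S := S
  confluent := fun _ _ hwv => h.monotone_map hwv
  V := fun w => {p | (Formula.var p : Formula P).toNat ≤ c ∧ lab w ((Formula.var p : Formula P).toNat)}
  monotone := fun w v hwv _ hp => ⟨hp.1, h.mono w v _ hp.1 hwv hp.2⟩

theorem left_le_pair_code {a b c i : ℕ} (h : 7 * Nat.pair a b + i ≤ c) : a ≤ c :=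
  (Nat.left_le_pair a b).trans (by omega)

theorem right_le_pair_code {a b c i : ℕ} (h : 7 * Nat.pair a b + i ≤ c) : b ≤ c :=
  (Nat.right_le_pair a b).trans (by omega)

theorem IsLabelling.sat_iff {c : ℕ} {W : Type u} [Nonempty W] [PartialOrder W] {S : W → W}
    {lab : W → ℕ → Prop} (h : IsLabelling P c S lab) (φ : Formula P) (hφ : φ.toNat ≤ c) (w : W) :
    Sat h.model w φ ↔ lab w (φ.toNat) := by
  induction φ generalizing w with
  | var p => exact ⟨fun hp => hp.2, fun hp => ⟨hφ, hp⟩⟩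
  | bot => exact ⟨False.elim, h.bot w⟩
  | and φ ψ ih₁ ih₂ =>
    exact ((ih₁ (left_le_pair_code hφ) w).and (ih₂ (right_le_pair_code hφ) w)).trans
      (h.and w _ _ ⟨φ, rfl⟩ ⟨ψ, rfl⟩ hφ).symm
  | or φ ψ ih₁ ih₂ =>
    exact ((ih₁ (left_le_pair_code hφ) w).or (ih₂ (right_le_pair_code hφ) w)).trans
      (h.or w _ _ ⟨φ, rfl⟩ ⟨ψ, rfl⟩ hφ).symm
  | imp φ ψ ih₁ ih₂ =>
    exact (forall_congr' fun v => imp_congr Iff.rfl (imp_congr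
      (ih₁ (left_le_pair_code hφ) v) (ih₂ (right_le_pair_code hφ) v))).trans
      (h.imp w _ _ ⟨φ, rfl⟩ ⟨ψ, rfl⟩ hφ).symm
  | next φ ih =>
    rw [Formula.toNat] at hφ
    exact (ih (by omega) (S w)).trans (h.next w _ ⟨φ, rfl⟩ hφ).symm
  | diamond φ ih =>
    rw [Formula.toNat] at hφ
    exact (exists_congr fun k => ih (by omega) (S^[k] w)).trans (h.diamond w _ ⟨φ, rfl⟩ hφ).symm
  | box φ ih =>
    rw [Formula.toNat] at hφ
    exact (forall_congr' fun k => ih (by omega) (S^[k] w)).trans (h.box w _ ⟨φ, rfl⟩ hφ).symm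

/-- A labelled dynamic preorder obeys the truth conditions if its labels and their changes are taken
from a model, it has witnesses for implications, and it meets all eventualities. -/
theorem isLabelling_of_simulation (M : Model.{u} P) (c : ℕ) {W : Type*} [Preorder W] (S : W → W)
    (lab : W → Finset ℕ) (hS : Monotone S) (hlab : Monotone lab)
    (hnext : ∀ x, ∃ v, label M c v = lab x ∧ label M c (M.S v) = lab (S x))
    (himp : ∀ x, ∃ v, label M c v = lab x ∧ ∀ u, v ≤ u → ∃ y, x ≤ y ∧ lab y = label M c u)
    (hfair : ∀ x r, r ≤ c → ∃ k : ℕ, ¬ Pending r (lab (S^[k] x))) :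
    IsLabelling P c S fun x n => n ∈ lab x where
  monotone_map := hS
  mono := fun w v n _ hwv hn => hlab hwv hn
  bot := by
    intro x
    obtain ⟨v, h, -⟩ := hnext x
    rw [← h]
    exact fun hb => (toNat_mem_label (φ := (Formula.bot : Formula P)) (Nat.zero_le c)).1 hb
  and := by
    rintro x _ _ ⟨φ, rfl⟩ ⟨ψ, rfl⟩ hc
    obtain ⟨v, h, -⟩ := hnext x
    rw [← h, toNat_mem_label (left_le_pair_code hc), toNat_mem_label (right_le_pair_code hc)]
    exact toNat_mem_label (φ := φ.and ψ) hc
  or := by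
    rintro x _ _ ⟨φ, rfl⟩ ⟨ψ, rfl⟩ hc
    obtain ⟨v, h, -⟩ := hnext x
    rw [← h, toNat_mem_label (left_le_pair_code hc), toNat_mem_label (right_le_pair_code hc)]
    exact toNat_mem_label (φ := φ.or ψ) hc
  imp := by
    rintro x _ _ ⟨φ, rfl⟩ ⟨ψ, rfl⟩ hc
    constructor
    · intro hx y hxy hy
      obtain ⟨v, h, -⟩ := hnext y
      -- Monotonicity moves the implication up to `y`, where modus ponens holds in the world of `M`
      -- with the same label.
      have h1 := hlab hxy hx
      rw [← h] at h1 hy ⊢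
      rw [toNat_mem_label (left_le_pair_code hc)] at hy
      rw [toNat_mem_label (right_le_pair_code hc)]
      exact (toNat_mem_label (φ := φ.imp ψ) hc).1 h1 v le_rfl hy
    · intro hx
      obtain ⟨v, h, hv⟩ := himp x
      rw [← h]
      refine (toNat_mem_label (φ := φ.imp ψ) hc).2 fun u hu hφ => ?_
      obtain ⟨y, h1, h2⟩ := hv u hu
      have h3 := hx y h1
      rw [h2, toNat_mem_label (left_le_pair_code hc),
        toNat_mem_label (right_le_pair_code hc)] at h3
      exact h3 hφ
  next := by
    rintro x _ ⟨φ, rfl⟩ hc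
    obtain ⟨v, h, h'⟩ := hnext x
    rw [← h, ← h', toNat_mem_label (φ := φ) (by omega)]
    exact toNat_mem_label (φ := φ.next) hc
  diamond := by
    rintro x _ ⟨φ, rfl⟩ hc
    have hφ : φ.toNat ≤ c := by omega
    have hloc : ∀ x, φ.diamond.toNat ∈ lab x ↔
        φ.toNat ∈ lab x ∨ φ.diamond.toNat ∈ lab (S x) := by
      intro x
      obtain ⟨v, h, h'⟩ := hnext x
      rw [← h, ← h', toNat_mem_label hφ, toNat_mem_label hc, toNat_mem_label hc]
      constructor
      · rintro ⟨_ | k, hk⟩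
        · exact Or.inl hk
        · exact Or.inr ⟨k, hk⟩
      · rintro (h | ⟨k, hk⟩)
        · exact ⟨0, h⟩
        · exact ⟨k + 1, hk⟩
    constructor
    · intro hx
      by_contra! hno
      -- Without a witness, local unfolding would keep the diamond pending forever, against
      -- fairness.
      have hall : ∀ k : ℕ, φ.diamond.toNat ∈ lab (S^[k] x) := by
        intro k
        induction k with
        | zero => exact hx
        | succ k ih =>
          rw [Function.iterate_succ_apply']
          exact ((hloc _).1 ih).resolve_left (hno k)
      obtain ⟨k, hk⟩ := hfair x _ hc
      exact hk (Or.inl ⟨φ.toNat, rfl, hall k, hno k⟩)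
    · rintro ⟨k, hk⟩
      induction k generalizing x with
      | zero => exact (hloc x).2 (Or.inl hk)
      | succ k ih => exact (hloc x).2 (Or.inr (ih (S x) hk))
  box := by
    rintro x _ ⟨φ, rfl⟩ hc
    have hφ : φ.toNat ≤ c := by omega
    have hloc : ∀ x, φ.box.toNat ∈ lab x ↔ φ.toNat ∈ lab x ∧ φ.box.toNat ∈ lab (S x) := by
      intro x
      obtain ⟨v, h, h'⟩ := hnext x
      rw [← h, ← h', toNat_mem_label hφ, toNat_mem_label hc, toNat_mem_label hc]
      exact ⟨fun h => ⟨h 0, fun k => h (k + 1)⟩, fun h k => k.casesOn h.1 h.2⟩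
    constructor
    · intro hx k
      induction k generalizing x with
      | zero => exact ((hloc x).1 hx).1
      | succ k ih => exact ih (S x) ((hloc x).1 hx).2
    · intro hall
      by_contra hx
      have hno : ∀ k : ℕ, φ.box.toNat ∉ lab (S^[k] x) := by
        intro k
        induction k with
        | zero => exact hx
        | succ k ih =>
          rw [Function.iterate_succ_apply']
          exact fun h => ih ((hloc _).2 ⟨hall k, h⟩)
      obtain ⟨k, hk⟩ := hfair x _ hc
      exact hk (Or.inr ⟨φ.toNat, rfl, hno k, hall k⟩)

end Labelling

/-! ### The finite model of trees with agendas. -/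

section TreeModel

variable {W : Type u} [Preorder W] {Q : Type} {S : W → W} {ℓ : W → Finset ℕ} {σ : W → Q}
  {lab : Q → Finset ℕ}

theorem WorldChain.concat {w u : W} {l : List W} (h : WorldChain ℓ w l)
    (hu : Above ℓ (tip w l) u) : WorldChain ℓ w (l ++ [u]) := by
  induction l generalizing w with
  | nil => exact List.isChain_pair.2 hu
  | cons v l ih =>
    obtain ⟨h1, h2⟩ := List.isChain_cons_cons.1 h
    exact List.isChain_cons_cons.2 ⟨h1, ih h2 hu⟩

theorem Typing.lab_subset (T : Typing S ℓ σ lab) {q c : Q} (h : Covers ℓ σ q c) :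
    lab q ⊆ lab c := by
  obtain ⟨w, v, h1, rfl, rfl⟩ := h
  rw [T.lab_eq, T.lab_eq]
  exact T.monotone_label h1.1

theorem Typing.lab_tip_append (T : Typing S ℓ σ lab) {q : Q} {a b : List Q}
    (h : Node ℓ σ q (a ++ b)) : lab (tip q a) ⊆ lab (tip q (a ++ b)) := by
  induction a generalizing q with
  | nil =>
    induction b generalizing q with
    | nil => exact subset_rfl
    | cons c b ih =>
      obtain ⟨h1, h2⟩ := List.isChain_cons_cons.1 h
      exact (T.lab_subset h1).trans (ih h2)
  | cons c a ih => exact ih (List.isChain_cons_cons.1 h).2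

theorem Typing.length_add_card_le (T : Typing S ℓ σ lab) {s : ℕ}
    (hs : ∀ w, ℓ w ⊆ Finset.range s) {w : W} {l : List W} (h : WorldChain ℓ w l) :
    l.length + (ℓ w).card ≤ s := by
  induction l generalizing w with
  | nil => simpa using card_label_le hs w
  | cons v l ih =>
    obtain ⟨h1, h2⟩ := List.isChain_cons_cons.1 h
    have := card_lt_of_above T.monotone_label h1
    have := ih h2
    rw [List.length_cons]
    omega

theorem Typing.node_length_le (T : Typing S ℓ σ lab) {s : ℕ}
    (hs : ∀ w, ℓ w ⊆ Finset.range s) {q : Set.range σ} {a : List Q} (h : Node ℓ σ q a) :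
    a.length ≤ s := by
  obtain ⟨_, w, rfl⟩ := q
  obtain ⟨ρ, h1, -⟩ := T.exists_chains (List.IsChain.singleton w)
  obtain ⟨h2, h3⟩ := h1 a h
  have := T.length_add_card_le hs h2
  rw [← h3, List.length_map]
  omega

/-- An obligation pending at a node of the tree of a type. -/
def NodePending (ℓ : W → Finset ℕ) (σ : W → Q) (lab : Q → Finset ℕ) (s : ℕ) (q : Set.range σ)
    (a : List Q) (r : Fin s) : Prop :=
  Node ℓ σ q a ∧ Pending r (lab (tip q a))

/-- The worlds of the model built from trees of types. -/
def TreeWorld (ℓ : W → Finset ℕ) (σ : W → Q) (lab : Q → Finset ℕ) (s : ℕ) : Type :=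
  {p : Agenda (NodePending ℓ σ lab s) × List Q // Node ℓ σ p.1.pos p.2}

instance (s : ℕ) : PartialOrder (TreeWorld ℓ σ lab s) where
  le x y := x.1.1 = y.1.1 ∧ x.1.2 <+: y.1.2
  le_refl _ := ⟨rfl, List.prefix_rfl⟩
  le_trans _ _ _ h₁ h₂ := ⟨h₁.1.trans h₂.1, h₁.2.trans h₂.2⟩
  le_antisymm x y h₁ h₂ := Subtype.ext (Prod.ext h₁.1 (h₁.2.eq_of_length_le h₂.2.length_le))

/-- The label of a world of the tree model. -/
def TreeWorld.label {s : ℕ} (x : TreeWorld ℓ σ lab s) : Finset ℕ := lab (tip x.1.1.pos.1 x.1.2)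

/-- The entries of a list up to a given length. -/
def entries (s : ℕ) (a : List Q) : Fin s → Option Q := fun i => a[(i : ℕ)]?

theorem entries_injOn (s : ℕ) : Set.InjOn (entries (Q := Q) s) {a | a.length ≤ s} := by
  intro a ha b hb h
  refine List.ext_getElem? fun i => ?_
  by_cases hi : i < s
  · exact congrFun h ⟨i, hi⟩
  · rw [List.getElem?_eq_none (ha.trans (not_lt.1 hi)),
      List.getElem?_eq_none (hb.trans (not_lt.1 hi))]

/-- A code for a world of the tree model in a finite type. -/
def TreeWorld.code {s : ℕ} (x : TreeWorld ℓ σ lab s) :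
    Q × Set ((Fin s → Option Q) × Fin s) × (Fin s → Option Q) :=
  (x.1.1.pos, Prod.map (entries s) id '' x.1.1.todo, entries s x.1.2)

/-- Nodes have length at most `s`, so their first `s` entries determine them. This applies also to
the nodes listed in an agenda, all of which belong to the tree of its position. -/
theorem TreeWorld.code_injective (T : Typing S ℓ σ lab) {s : ℕ}
    (hs : ∀ w, ℓ w ⊆ Finset.range s) :
    Function.Injective (TreeWorld.code (ℓ := ℓ) (σ := σ) (lab := lab) (s := s)) := by
  rintro ⟨⟨⟨q, A, hA⟩, a⟩, ha⟩ ⟨⟨⟨q', A', hA'⟩, a'⟩, ha'⟩ h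
  simp only [TreeWorld.code, Prod.mk.injEq] at h
  obtain ⟨h1, h2, h3⟩ := h
  obtain rfl := Subtype.ext h1
  obtain rfl := entries_injOn s (T.node_length_le hs ha) (T.node_length_le hs ha') h3
  have hinj : Set.InjOn (Prod.map (entries (Q := Q) s) (id : Fin s → Fin s))
      {p | p.1.length ≤ s} := by
    rintro ⟨b, r⟩ hb ⟨b', r'⟩ hb' hbr
    simp only [Prod.map_apply, id, Prod.mk.injEq] at hbr
    exact Prod.ext (entries_injOn s hb hb' hbr.1) hbr.2
  obtain rfl := (hinj.image_eq_image_iff (fun p hp => T.node_length_le hs (hA p hp).1)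
    fun p hp => T.node_length_le hs (hA' p hp).1).1 h2
  rfl

/-- The tree model obeys the labels of the given structure. -/
theorem Typing.exists_treeModel (T : Typing S ℓ σ lab) {s : ℕ}
    (hs : ∀ w, ℓ w ⊆ Finset.range s)
    (hg : ∀ r < s, ∀ v, ∃ k : ℕ, ¬ Pending r (ℓ (S^[k] v))) [Finite Q] :
    ∃ F : TreeWorld ℓ σ lab s → TreeWorld ℓ σ lab s, Monotone F ∧
      (∀ x, ∃ v, ℓ v = x.label ∧ ℓ (S v) = (F x).label) ∧
      ∀ x, ∀ r < s, ∃ k : ℕ, ¬ Pending r (F^[k] x).label := by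
  have hfin : ∀ q, {p : List Q × Fin s | NodePending ℓ σ lab s q p.1 p.2}.Finite := by
    intro q
    refine ((List.finite_length_le Q s).prod Set.finite_univ).subset fun p hp => ?_
    exact ⟨T.node_length_le hs hp.1, trivial⟩
  have hreach : ∀ q a (r : Fin s), NodePending ℓ σ lab s q a r →
      ∃ p, Relation.ReflTransGen (Moves (TypeTransition S ℓ σ lab)) (q, a) p ∧
        ¬ NodePending ℓ σ lab s p.1 p.2 r := by
    intro q a r h
    obtain ⟨p, h1, h2⟩ := T.exists_moves (good := fun L => ¬ Pending r L) (hg r r.2) h.1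
    exact ⟨p, h1, fun h => h2 h.2⟩
  have hserial : ∀ q, ∃ q' g, TypeTransition S ℓ σ lab q q' g := by
    rintro ⟨_, w, rfl⟩
    obtain ⟨g, h, -⟩ := T.exists_transition (List.IsChain.singleton w)
    exact ⟨⟨_, S w, rfl⟩, g, h⟩
  obtain ⟨F, g, h1, h2⟩ := exists_strategy hfin hreach hserial
  let F' : TreeWorld ℓ σ lab s → TreeWorld ℓ σ lab s := fun x =>
    ⟨(F x.1.1, g x.1.1 x.1.2), (h1 x.1.1).node _ x.2⟩
  have hval : ∀ (k : ℕ) x, (F'^[k] x).1 =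
      (fun p : Agenda (NodePending ℓ σ lab s) × List Q => (F p.1, g p.1 p.2))^[k] x.1 := by
    intro k
    induction k with
    | zero => exact fun x => rfl
    | succ k ih => exact fun x => ih (F' x)
  refine ⟨F', ?_, fun x => (h1 x.1.1).label _ x.2, fun x r hr => ?_⟩
  -- Comparable worlds share their agenda, hence are moved by the same monotone tree map.
  · rintro ⟨⟨A, a⟩, ha⟩ ⟨⟨B, b⟩, hb⟩ ⟨h3, h4⟩
    obtain rfl : A = B := h3
    exact ⟨rfl, (h1 A).mono _ _ h4⟩
  · obtain ⟨k, hk⟩ := h2 x.1.1 x.1.2 ⟨r, hr⟩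
    refine ⟨k, fun h => hk ?_⟩
    rw [TreeWorld.label, hval] at h
    exact ⟨hval k x ▸ (F'^[k] x).2, h⟩

end TreeModel

/-- A bound for the size of a model in which a formula with a given Gödel number fails. -/
def sizeBound (c : ℕ) : ℕ :=
  typeBound (c + 1) (c + 1) * (2 ^ ((typeBound (c + 1) (c + 1) + 1) ^ (c + 1) * (c + 1)) *
    (typeBound (c + 1) (c + 1) + 1) ^ (c + 1))

theorem exists_finite_labelling {P : Type v} [Encodable P] (M : Model.{u} P) (w : M.W)
    (φ : Formula P) (h : ¬ Sat M w φ) :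
    ∃ (W : Type) (_ : Finite W) (_ : PartialOrder W) (S : W → W) (lab : W → ℕ → Prop),
      IsLabelling P φ.toNat S lab ∧ Nat.card W ≤ sizeBound φ.toNat ∧ ∃ x, ¬ lab x φ.toNat := by
  classical
  generalize hc : φ.toNat = c
  obtain ⟨σ, h1, h2⟩ := exists_typing (label_monotone (M := M) (c := c)) label_subset
  -- Types that no world realises get the empty label as a dummy value.
  let lab : Fin (typeBound (c + 1) (c + 1)) → Finset ℕ := fun q =>
    if h : ∃ w, σ w = q then label M c h.choose else ∅
  have T : Typing M.S (label M c) σ lab := by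
    refine ⟨M.monotone_map, label_monotone, fun w => ?_, h2⟩
    have hw : ∃ v, σ v = σ w := ⟨w, rfl⟩
    simp only [lab, dif_pos hw]
    exact h1 _ _ hw.choose_spec
  obtain ⟨F, h3, h4, h5⟩ := T.exists_treeModel label_subset
    fun r hr v => exists_not_pending M (Nat.lt_succ_iff.1 hr) v
  have hinj := TreeWorld.code_injective T label_subset
  refine ⟨TreeWorld (label M c) σ lab (c + 1), Finite.of_injective _ hinj, inferInstance, F,
    fun x n => n ∈ x.label, ?_, ?_, ?_⟩
  · refine isLabelling_of_simulation M c F TreeWorld.label h3 ?_ h4 ?_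
      fun x r hr => h5 x r (Nat.lt_succ_of_le hr)
    · rintro ⟨⟨A, a⟩, ha⟩ ⟨⟨B, b⟩, hb⟩ ⟨h6, t, h7⟩
      obtain rfl : A = B := h6
      obtain rfl : a ++ t = b := h7
      exact T.lab_tip_append hb
    · rintro ⟨⟨⟨⟨_, w, rfl⟩, A, hA⟩, a⟩, ha⟩
      obtain ⟨ρ, h6, -⟩ := T.exists_chains (List.IsChain.singleton w)
      obtain ⟨h7, h8⟩ := h6 a ha
      have h9 : lab (tip (σ w) a) = label M c (tip w (ρ a)) := by
        rw [← T.lab_eq, ← tip_map σ, h8]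
      refine ⟨tip w (ρ a), h9.symm, fun u hu => ?_⟩
      -- A world above with the same label is represented by the node itself, one with a new label
      -- by a child of the node.
      by_cases hl : label M c u = label M c (tip w (ρ a))
      · exact ⟨_, le_rfl, h9.trans hl.symm⟩
      · have h10 := node_map (σ := σ) (h7.concat ⟨hu, hl⟩)
        rw [List.map_append, h8] at h10
        refine ⟨⟨⟨_, a ++ [σ u]⟩, h10⟩, ⟨rfl, List.prefix_append _ _⟩, ?_⟩
        change lab (tip (σ w) (a ++ [σ u])) = _
        rw [tip_append]
        exact T.lab_eq u
  · refine (Nat.card_le_card_of_injective _ hinj).trans_eq ?_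
    simp [sizeBound, Nat.card_eq_fintype_card]
  -- The root of the tree of the type of `w`, with an empty agenda, carries the label of `w`.
  · refine ⟨⟨⟨⟨⟨σ w, w, rfl⟩, ∅, by simp⟩, []⟩, List.IsChain.singleton _⟩, fun hx => h ?_⟩
    change c ∈ lab (σ w) at hx
    rw [T.lab_eq, ← hc] at hx
    exact (toNat_mem_label le_rfl).1 hx

/-! ### Coding finite structures by numbers. -/

theorem exists_iterate_lt {α : Type*} [Finite α] (f : α → α) (p : α → Prop) (a : α)
    (h : ∃ k : ℕ, p (f^[k] a)) : ∃ k < Nat.card α, p (f^[k] a) := by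
  classical
  refine ⟨Nat.find h, ?_, Nat.find_spec h⟩
  by_contra! hlt
  have hcard : Nat.card α < Nat.card (Fin (Nat.card α + 1)) := by simp
  obtain ⟨i, j, hne, hij⟩ : ∃ i j : Fin (Nat.card α + 1), i ≠ j ∧ f^[i] a = f^[j] a := by
    by_contra! hinj
    exact hcard.not_ge (Nat.card_le_card_of_injective (fun i : Fin (Nat.card α + 1) => f^[i] a)
      fun i j hij => by_contra fun hne => hinj i j hne hij)
  wlog hlt' : i < j generalizing i j
  · exact this j i hne.symm hij.symm (lt_of_le_of_ne (not_lt.1 hlt') hne.symm)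
  have hi : (i : ℕ) < j := hlt'
  have hj : (j : ℕ) ≤ Nat.find h := (Nat.lt_succ_iff.1 j.2).trans hlt
  -- Cutting out the loop between the equal iterates `i < j` would give an earlier hit.
  refine Nat.find_min h (m := Nat.find h - j + i) (by omega) ?_
  rw [Function.iterate_add_apply, hij, ← Function.iterate_add_apply, Nat.sub_add_cancel hj]
  exact Nat.find_spec h

/-- The digit of `m` with index `i` in base `b`. -/
def digit (b m i : ℕ) : ℕ := m / b ^ i % b

theorem exists_digits {b : ℕ} (hb : 0 < b) (n : ℕ) (f : ℕ → ℕ) (hf : ∀ i < n, f i < b) :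
    ∃ m < b ^ n, ∀ i < n, digit b m i = f i := by
  induction n with
  | zero => exact ⟨0, by simp, by simp⟩
  | succ n ih =>
    obtain ⟨m, hm, hd⟩ := ih fun i hi => hf i (by omega)
    have hfn := hf n (by omega)
    refine ⟨m + b ^ n * f n, ?_, fun i hi => ?_⟩
    · calc m + b ^ n * f n < b ^ n + b ^ n * f n := by omega
        _ = b ^ n * (f n + 1) := by ring
        _ ≤ b ^ n * b := Nat.mul_le_mul_left _ hfn
        _ = b ^ (n + 1) := (pow_succ b n).symm
    · rcases Nat.lt_succ_iff_lt_or_eq.1 hi with h | rfl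
      · rw [← hd i h, digit, digit]
        obtain ⟨k, rfl⟩ : ∃ k, n = i + 1 + k := ⟨n - (i + 1), by omega⟩
        have : b ^ (i + 1 + k) * f (i + 1 + k) = b ^ i * (b * (b ^ k * f (i + 1 + k))) := by ring
        rw [this, Nat.add_mul_div_left _ _ (pow_pos hb i), Nat.add_mul_mod_self_left]
      · rw [digit, Nat.add_mul_div_left _ _ (pow_pos hb i), Nat.div_eq_of_lt hm, zero_add,
          Nat.mod_eq_of_lt hfn]

theorem exists_bits (n : ℕ) (p : ℕ → Prop) : ∃ m < 2 ^ n, ∀ i < n, digit 2 m i = 1 ↔ p i := by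
  classical
  obtain ⟨m, hm, h⟩ := exists_digits two_pos n (fun i => if p i then 1 else 0)
    fun i _ => by split_ifs <;> omega
  refine ⟨m, hm, fun i hi => ?_⟩
  rw [h i hi]
  split_ifs with hp <;> simp [hp]

/-- Codes for finite labelled structures: a bound for the Gödel numbers, the number of worlds, and
numbers whose digits describe the order, the successor function and the labels. -/
abbrev ModelCode : Type := ℕ × ℕ × ℕ × ℕ × ℕ

namespace ModelCode

/-- The order relation of a code. -/
def le (p : ModelCode) (i j : ℕ) : Prop := digit 2 p.2.2.1 (p.2.1 * i + j) = 1

/-- The successor function of a code. -/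
def succ (p : ModelCode) (i : ℕ) : ℕ := digit p.2.1 p.2.2.2.1 i

/-- The labels of a code. -/
def lab (p : ModelCode) (i n : ℕ) : Prop := digit 2 p.2.2.2.2 ((p.1 + 1) * i + n) = 1

/-- The code describes a finite labelled structure that obeys the truth conditions and in which the
Gödel number `p.1` is missing from some label. -/
structure Refutes (P : Type v) [Encodable P] (p : ModelCode) : Prop where
  refl : ∀ i < p.2.1, p.le i i
  trans : ∀ i < p.2.1, ∀ j < p.2.1, ∀ k < p.2.1, p.le i j → p.le j k → p.le i k
  antisymm : ∀ i < p.2.1, ∀ j < p.2.1, p.le i j → p.le j i → i = j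
  monotone : ∀ i < p.2.1, ∀ j < p.2.1, p.le i j → p.le (p.succ i) (p.succ j)
  mono : ∀ i < p.2.1, ∀ j < p.2.1, ∀ n < p.1 + 1, p.le i j → p.lab i n → p.lab j n
  bot : ∀ i < p.2.1, ¬ p.lab i 0
  and : ∀ i < p.2.1, ∀ a < p.1 + 1, ∀ b < p.1 + 1, IsCode P a → IsCode P b →
    7 * Nat.pair a b + 5 ≤ p.1 → (p.lab i (7 * Nat.pair a b + 5) ↔ p.lab i a ∧ p.lab i b)
  or : ∀ i < p.2.1, ∀ a < p.1 + 1, ∀ b < p.1 + 1, IsCode P a → IsCode P b →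
    7 * Nat.pair a b + 6 ≤ p.1 → (p.lab i (7 * Nat.pair a b + 6) ↔ p.lab i a ∨ p.lab i b)
  imp : ∀ i < p.2.1, ∀ a < p.1 + 1, ∀ b < p.1 + 1, IsCode P a → IsCode P b →
    7 * Nat.pair a b + 7 ≤ p.1 →
    (p.lab i (7 * Nat.pair a b + 7) ↔ ∀ j < p.2.1, p.le i j → p.lab j a → p.lab j b)
  next : ∀ i < p.2.1, ∀ a < p.1 + 1, IsCode P a → 7 * a + 2 ≤ p.1 →
    (p.lab i (7 * a + 2) ↔ p.lab (p.succ i) a)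
  diamond : ∀ i < p.2.1, ∀ a < p.1 + 1, IsCode P a → 7 * a + 3 ≤ p.1 →
    (p.lab i (7 * a + 3) ↔ ∃ k < p.2.1, p.lab (p.succ^[k] i) a)
  box : ∀ i < p.2.1, ∀ a < p.1 + 1, IsCode P a → 7 * a + 4 ≤ p.1 →
    (p.lab i (7 * a + 4) ↔ ∀ k < p.2.1, p.lab (p.succ^[k] i) a)
  fails : ∃ i < p.2.1, ¬ p.lab i p.1

/-- The worlds of the structure described by a code. -/
structure World (p : ModelCode) : Type u where
  idx : ℕ
  lt : idx < p.2.1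

theorem World.ext_idx {p : ModelCode} {w v : World.{u} p} (h : w.idx = v.idx) : w = v := by
  cases w; cases v; cases h; rfl

theorem World.idx_bijective (p : ModelCode) :
    Function.Bijective fun w : World.{u} p => (⟨w.idx, w.lt⟩ : Fin p.2.1) :=
  ⟨fun _ _ h => World.ext_idx (Fin.mk.inj_iff.1 h), fun i => ⟨⟨i.1, i.2⟩, rfl⟩⟩

instance (p : ModelCode) : Finite (World.{u} p) := Finite.of_injective _ (World.idx_bijective p).1

theorem World.card (p : ModelCode) : Nat.card (World.{u} p) = p.2.1 := by
  rw [Nat.card_eq_of_bijective _ (World.idx_bijective p), Nat.card_fin]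

variable {P : Type v} [Encodable P]

/-- The order of the structure described by a code. -/
abbrev Refutes.partialOrder {p : ModelCode} (h : p.Refutes P) : PartialOrder (World.{u} p) where
  le w v := p.le w.idx v.idx
  le_refl w := h.refl _ w.lt
  le_trans u v w := h.trans _ u.lt _ v.lt _ w.lt
  le_antisymm v w h₁ h₂ := World.ext_idx (h.antisymm _ v.lt _ w.lt h₁ h₂)

/-- Decoding yields a labelling, whose model agrees with it on all codes up to `φ.toNat`. The worlds
are wrapped in `World` to lie in the required universe. -/
theorem Refutes.exists_not_sat {φ : Formula P} {N x y z : ℕ}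
    (h : Refutes P (φ.toNat, N, x, y, z)) : ∃ (M : Model.{u} P) (w : M.W), ¬ Sat M w φ := by
  obtain ⟨p, hp⟩ : ∃ p : ModelCode, (φ.toNat, N, x, y, z) = p := ⟨_, rfl⟩
  rw [hp] at h
  have hc : φ.toNat = p.1 := by rw [← hp]
  obtain ⟨i₀, hi₀, hno⟩ := h.fails
  have hpos : 0 < p.2.1 := (Nat.zero_le _).trans_lt hi₀
  let _ : PartialOrder (World.{u} p) := h.partialOrder
  have _ : Nonempty (World.{u} p) := ⟨⟨i₀, hi₀⟩⟩
  let S : World.{u} p → World.{u} p := fun w => ⟨p.succ w.idx, Nat.mod_lt _ hpos⟩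
  have hS : ∀ (k : ℕ) (w : World.{u} p), (S^[k] w).idx = p.succ^[k] w.idx := by
    intro k
    induction k with
    | zero => exact fun w => rfl
    | succ k ih => exact fun w => ih (S w)
  have hlab : IsLabelling P p.1 S fun w n => p.lab w.idx n :=
    { monotone_map := fun w v hwv => h.monotone _ w.lt _ v.lt hwv
      mono := fun w v n hn hwv => h.mono _ w.lt _ v.lt n (Nat.lt_succ_of_le hn) hwv
      bot := fun w => h.bot _ w.lt
      and := fun w a b ha hb hab => h.and _ w.lt a (Nat.lt_succ_of_le (left_le_pair_code hab)) b
        (Nat.lt_succ_of_le (right_le_pair_code hab)) ha hb hab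
      or := fun w a b ha hb hab => h.or _ w.lt a (Nat.lt_succ_of_le (left_le_pair_code hab)) b
        (Nat.lt_succ_of_le (right_le_pair_code hab)) ha hb hab
      imp := fun w a b ha hb hab =>
        (h.imp _ w.lt a (Nat.lt_succ_of_le (left_le_pair_code hab)) b
          (Nat.lt_succ_of_le (right_le_pair_code hab)) ha hb hab).trans
          ⟨fun h v => h v.idx v.lt, fun h j hj => h ⟨j, hj⟩⟩
      next := fun w a ha hab => h.next _ w.lt a (by omega) ha hab
      diamond := fun w a ha hab => by
        rw [h.diamond _ w.lt a (by omega) ha hab]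
        simp only [hS]
        refine ⟨fun ⟨k, _, hk⟩ => ⟨k, hk⟩, fun hk => ?_⟩
        -- On `p.2.1` worlds an orbit repeats in time, so the bounded temporal quantifier is as
        -- strong as the unbounded one.
        have := exists_iterate_lt S (fun v => p.lab v.idx a) w (by simpa only [hS] using hk)
        simpa only [hS, World.card] using this
      box := fun w a ha hab => by
        rw [h.box _ w.lt a (by omega) ha hab]
        simp only [hS]
        refine ⟨fun hk => ?_, fun h k _ => h k⟩
        by_contra hno
        have := exists_iterate_lt S (fun v => ¬ p.lab v.idx a) w
          (by simpa only [hS, not_forall] using hno)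
        simp only [hS, World.card] at this
        obtain ⟨k, h1, h2⟩ := this
        exact h2 (hk k h1) }
  refine ⟨hlab.model, (⟨i₀, hi₀⟩ : World.{u} p), fun hsat => hno ?_⟩
  have := (hlab.sat_iff φ hc.le _).1 hsat
  rwa [hc] at this

theorem exists_refutes {c : ℕ} {W : Type u} [Finite W] [PartialOrder W] {S : W → W}
    {lab : W → ℕ → Prop} (h : IsLabelling P c S lab) (hno : ∃ w, ¬ lab w c) :
    ∃ x < 2 ^ (Nat.card W * Nat.card W), ∃ y < Nat.card W ^ Nat.card W,
      ∃ z < 2 ^ ((c + 1) * Nat.card W), Refutes P (c, Nat.card W, x, y, z) := by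
  have hinst : Nonempty W := hno.nonempty
  obtain ⟨N, hN⟩ : ∃ N, Nat.card W = N := ⟨_, rfl⟩
  have hpos : 0 < N := hN ▸ Nat.card_pos
  obtain ⟨u, idx, hidx, hu, hui⟩ : ∃ (u : ℕ → W) (idx : W → ℕ), (∀ w, idx w < N) ∧
      (∀ w, u (idx w) = w) ∧ ∀ i < N, idx (u i) = i := by
    have e : W ≃ Fin N := hN ▸ Finite.equivFin W
    refine ⟨fun i => e.symm ⟨i % N, Nat.mod_lt _ hpos⟩, fun w => e w, fun w => (e w).2,
      fun w => ?_, fun i hi => ?_⟩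
    · simp [Nat.mod_eq_of_lt (e w).2]
    · simp [Nat.mod_eq_of_lt hi]
  have hexu : ∀ {r : W → Prop}, (∀ w, r w) ↔ ∀ i < N, r (u i) := fun {r} =>
    ⟨fun h i _ => h _, fun h w => hu w ▸ h _ (hidx w)⟩
  rw [hN]
  -- Pairs are flattened to `N * i + j` for the order and to `(c + 1) * i + n` for the labels;
  -- quotient and remainder recover them.
  obtain ⟨x, hx, hx'⟩ := exists_bits (N * N) fun k => u (k / N) ≤ u (k % N)
  obtain ⟨y, hy, hy'⟩ := exists_digits hpos N (fun i => idx (S (u i))) fun i _ => hidx _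
  obtain ⟨z, hz, hz'⟩ := exists_bits ((c + 1) * N) fun k => lab (u (k / (c + 1))) (k % (c + 1))
  refine ⟨x, hx, y, hy, z, hz, ?_⟩
  obtain ⟨p, hp⟩ : ∃ p : ModelCode, (c, N, x, y, z) = p := ⟨_, rfl⟩
  rw [hp]
  obtain ⟨hp1, hp2⟩ : p.1 = c ∧ p.2.1 = N := by rw [← hp]; exact ⟨rfl, rfl⟩
  have hle : ∀ i < N, ∀ j < N, (p.le i j ↔ u i ≤ u j) := by
    intro i hi j hj
    have hlt : N * i + j < N * N := by
      calc N * i + j < N * i + N := by omega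
        _ = N * (i + 1) := by ring
        _ ≤ N * N := Nat.mul_le_mul_left _ hi
    have := hx' (N * i + j) hlt
    rw [Nat.mul_add_div hpos, Nat.div_eq_of_lt hj, add_zero, Nat.mul_add_mod,
      Nat.mod_eq_of_lt hj] at this
    rw [← hp]
    exact this
  have hlab : ∀ i < N, ∀ n ≤ c, (p.lab i n ↔ lab (u i) n) := by
    intro i hi n hn
    have hlt : (c + 1) * i + n < (c + 1) * N := by
      calc (c + 1) * i + n < (c + 1) * i + (c + 1) := by omega
        _ = (c + 1) * (i + 1) := by ring
        _ ≤ (c + 1) * N := Nat.mul_le_mul_left _ hi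
    have hn' := Nat.lt_succ_of_le hn
    have := hz' ((c + 1) * i + n) hlt
    rw [Nat.mul_add_div (Nat.succ_pos c), Nat.div_eq_of_lt hn', add_zero, Nat.mul_add_mod,
      Nat.mod_eq_of_lt hn'] at this
    rw [← hp]
    exact this
  have hsucc : ∀ i < N, p.succ i < N ∧ u (p.succ i) = S (u i) := by
    intro i hi
    have : p.succ i = idx (S (u i)) := by rw [← hp]; exact hy' i hi
    rw [this]
    exact ⟨hidx _, hu _⟩
  have hiter : ∀ k : ℕ, ∀ i < N, p.succ^[k] i < N ∧ u (p.succ^[k] i) = S^[k] (u i) := by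
    intro k
    induction k with
    | zero => exact fun i hi => ⟨hi, rfl⟩
    | succ k ih =>
      intro i hi
      obtain ⟨h1, h2⟩ := ih _ (hsucc i hi).1
      rw [(hsucc i hi).2] at h2
      exact ⟨h1, h2⟩
  have hlabk : ∀ k : ℕ, ∀ i < N, ∀ n ≤ c, (p.lab (p.succ^[k] i) n ↔ lab (S^[k] (u i)) n) := by
    intro k i hi n hn
    rw [hlab _ (hiter k i hi).1 n hn, (hiter k i hi).2]
  constructor <;> simp only [hp1, hp2, Nat.lt_succ_iff]
  · exact fun i hi => (hle i hi i hi).2 le_rfl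
  · intro i hi j hj k hk
    rw [hle i hi j hj, hle j hj k hk, hle i hi k hk]
    exact le_trans
  · intro i hi j hj h1 h2
    rw [← hui i hi, ← hui j hj]
    exact congrArg idx (le_antisymm ((hle i hi j hj).1 h1) ((hle j hj i hi).1 h2))
  · intro i hi j hj h1
    rw [hle _ (hsucc i hi).1 _ (hsucc j hj).1, (hsucc i hi).2, (hsucc j hj).2]
    exact h.monotone_map ((hle i hi j hj).1 h1)
  · intro i hi j hj n hn
    rw [hle i hi j hj, hlab i hi n hn, hlab j hj n hn]
    exact h.mono _ _ n hn
  · intro i hi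
    rw [hlab i hi 0 (Nat.zero_le c)]
    exact h.bot _
  · intro i hi a ha b hb hca hcb hab
    rw [hlab i hi _ hab, hlab i hi a ha, hlab i hi b hb]
    exact h.and _ _ _ hca hcb hab
  · intro i hi a ha b hb hca hcb hab
    rw [hlab i hi _ hab, hlab i hi a ha, hlab i hi b hb]
    exact h.or _ _ _ hca hcb hab
  · intro i hi a ha b hb hca hcb hab
    rw [hlab i hi _ hab, h.imp _ _ _ hca hcb hab, hexu]
    refine forall_congr' fun j => forall_congr' fun hj => ?_
    rw [hle i hi j hj, hlab j hj a ha, hlab j hj b hb]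
  · intro i hi a ha hca hab
    rw [hlab i hi _ hab, hlab _ (hsucc i hi).1 a ha, (hsucc i hi).2]
    exact h.next _ _ hca hab
  · intro i hi a ha hca hab
    rw [hlab i hi _ hab, h.diamond _ _ hca hab]
    simp only [hlabk _ i hi a ha]
    exact ⟨fun hk => hN ▸ exists_iterate_lt S (fun w => lab w a) (u i) hk,
      fun ⟨k, _, hk⟩ => ⟨k, hk⟩⟩
  · intro i hi a ha hca hab
    rw [hlab i hi _ hab, h.box _ _ hca hab]
    simp only [hlabk _ i hi a ha]
    refine ⟨fun h k _ => h k, fun hk => ?_⟩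
    by_contra! hno
    obtain ⟨k, h1, h2⟩ := exists_iterate_lt S (fun w => ¬ lab w a) (u i) hno
    exact h2 (hk k (hN ▸ h1))
  · obtain ⟨w, hw⟩ := hno
    refine ⟨idx w, hidx w, ?_⟩
    rw [hlab _ (hidx w) c le_rfl, hu]
    exact hw

end ModelCode

open ModelCode in
/-- A formula fails in some model if and only if it fails in a finite model of bounded size. -/
theorem not_valid_iff {P : Type v} [Encodable P] (φ : Formula P) :
    ¬ Valid.{u} φ ↔ ∃ N < sizeBound φ.toNat + 1, ∃ x < 2 ^ (N * N), ∃ y < N ^ N,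
      ∃ z < 2 ^ ((φ.toNat + 1) * N), Refutes P (φ.toNat, N, x, y, z) := by
  constructor
  · intro h
    simp only [Valid, not_forall] at h
    obtain ⟨M, w, hw⟩ := h
    obtain ⟨W, _, _, S, lab, h1, h2, h3⟩ := exists_finite_labelling M w φ hw
    exact ⟨Nat.card W, Nat.lt_succ_of_le h2, exists_refutes h1 h3⟩
  · rintro ⟨N, -, x, -, y, -, z, -, h⟩ hv
    obtain ⟨M, w, hw⟩ := h.exists_not_sat.{u}
    exact hw (hv M w)

/-! ### Primitive recursiveness of the bounds and of the check. -/

section Closure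

variable {α : Type*} [Primcodable α]

theorem primrecPred_forall_lt {R : α → ℕ → Prop} {f : α → ℕ} (hf : Primrec f)
    (hR : PrimrecPred fun q : α × ℕ => R q.1 q.2) : PrimrecPred fun a => ∀ x < f a, R a x := by
  have h : PrimrecRel fun (x : ℕ) (a : α) => R a x :=
    hR.comp (Primrec.pair Primrec.snd Primrec.fst)
  exact (h.forall_mem_list.comp (Primrec.list_range.comp hf) Primrec.id).of_eq (by simp)

theorem primrecPred_exists_lt {R : α → ℕ → Prop} {f : α → ℕ} (hf : Primrec f)
    (hR : PrimrecPred fun q : α × ℕ => R q.1 q.2) : PrimrecPred fun a => ∃ x < f a, R a x := by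
  have h : PrimrecRel fun (x : ℕ) (a : α) => R a x :=
    hR.comp (Primrec.pair Primrec.snd Primrec.fst)
  exact (h.exists_mem_list.comp (Primrec.list_range.comp hf) Primrec.id).of_eq (by simp)

theorem primrecPred_imp {p q : α → Prop} (hp : PrimrecPred p) (hq : PrimrecPred q) :
    PrimrecPred fun a => p a → q a :=
  (hp.not.or hq).of_eq fun _ => imp_iff_not_or.symm

theorem primrecPred_iff {p q : α → Prop} (hp : PrimrecPred p) (hq : PrimrecPred q) :
    PrimrecPred fun a => p a ↔ q a :=
  ((primrecPred_imp hp hq).and (primrecPred_imp hq hp)).of_eq fun _ => iff_def.symm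

theorem primrec_pow {f g : α → ℕ} (hf : Primrec f) (hg : Primrec g) :
    Primrec fun a => f a ^ g a :=
  (Primrec₂.unpaired'.1 Nat.Primrec.pow).comp hf hg

theorem primrec_mul {f g : α → ℕ} (hf : Primrec f) (hg : Primrec g) :
    Primrec fun a => f a * g a :=
  Primrec.nat_mul.comp hf hg

theorem primrec_add {f g : α → ℕ} (hf : Primrec f) (hg : Primrec g) :
    Primrec fun a => f a + g a :=
  Primrec.nat_add.comp hf hg

theorem primrec_digit {b m i : α → ℕ} (hb : Primrec b) (hm : Primrec m) (hi : Primrec i) :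
    Primrec fun a => digit (b a) (m a) (i a) :=
  Primrec.nat_mod.comp (Primrec.nat_div.comp hm (primrec_pow hb hi)) hb

theorem primrec_code {f : α → ℕ} (hf : Primrec f) (k : ℕ) : Primrec fun a => 7 * f a + k :=
  primrec_add (primrec_mul (Primrec.const 7) hf) (Primrec.const k)

theorem primrec_typeBound : Primrec fun s => typeBound s s := by
  have h : Primrec fun s : ℕ => (Nat.rec (2 ^ s) (fun _ t => 2 ^ s * 2 ^ t) s : ℕ) := by
    refine Primrec.nat_rec' (h := fun s (q : ℕ × ℕ) => 2 ^ s * 2 ^ q.2) Primrec.id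
      (primrec_pow (Primrec.const 2) Primrec.id) ?_
    exact primrec_mul (primrec_pow (Primrec.const 2) Primrec.fst)
      (primrec_pow (Primrec.const 2) (Primrec.snd.comp Primrec.snd))
  have hrec : ∀ s n, typeBound s n = Nat.rec (2 ^ s) (fun _ t => 2 ^ s * 2 ^ t) n := by
    intro s n
    induction n with
    | zero => rfl
    | succ n ih => rw [typeBound, ih]
  exact h.of_eq fun s => (hrec s s).symm

theorem primrec_sizeBound : Primrec sizeBound := by
  have hB : Primrec fun c => typeBound (c + 1) (c + 1) := primrec_typeBound.comp Primrec.succ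
  have hX := primrec_pow (primrec_add hB (Primrec.const 1)) Primrec.succ
  exact primrec_mul hB
    (primrec_mul (primrec_pow (Primrec.const 2) (primrec_mul hX Primrec.succ)) hX)

end Closure

namespace ModelCode

section

variable {α : Type*} [Primcodable α] {p : α → ModelCode} {i j : α → ℕ}

theorem primrec_size (hp : Primrec p) : Primrec fun a => (p a).2.1 :=
  Primrec.fst.comp (Primrec.snd.comp hp)

theorem primrec_bound (hp : Primrec p) : Primrec fun a => (p a).1 + 1 :=
  Primrec.succ.comp (Primrec.fst.comp hp)

theorem primrecPred_le (hp : Primrec p) (hi : Primrec i) (hj : Primrec j) :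
    PrimrecPred fun a => (p a).le (i a) (j a) :=
  Primrec.eq.comp (primrec_digit (Primrec.const 2)
    (Primrec.fst.comp (Primrec.snd.comp (Primrec.snd.comp hp)))
    (primrec_add (primrec_mul (primrec_size hp) hi) hj)) (Primrec.const 1)

theorem primrec_succ (hp : Primrec p) (hi : Primrec i) : Primrec fun a => (p a).succ (i a) :=
  primrec_digit (primrec_size hp)
    (Primrec.fst.comp (Primrec.snd.comp (Primrec.snd.comp (Primrec.snd.comp hp)))) hi

theorem primrecPred_lab (hp : Primrec p) (hi : Primrec i) (hj : Primrec j) :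
    PrimrecPred fun a => (p a).lab (i a) (j a) :=
  Primrec.eq.comp (primrec_digit (Primrec.const 2)
    (Primrec.snd.comp (Primrec.snd.comp (Primrec.snd.comp (Primrec.snd.comp hp))))
    (primrec_add (primrec_mul (primrec_bound hp) hi) hj)) (Primrec.const 1)

theorem primrec_iterate (hp : Primrec p) (hi : Primrec i) (hj : Primrec j) :
    Primrec fun a => (p a).succ^[j a] (i a) :=
  Primrec.nat_iterate hj hi (primrec_succ (hp.comp Primrec.fst) Primrec.snd)

end

/-- This is where the effective presentation of the variables enters the check. -/
theorem primrecPred_isCode (P : Type v) [Primcodable P] : PrimrecPred (IsCode P) :=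
  Primcodable.mem_range_encode (α := Formula P)

/-- A clause about a world and two Gödel numbers, as in `Refutes`, is primitive recursive. -/
theorem primrecPred_binary (P : Type v) [Primcodable P] (t : ℕ) {R : ModelCode → ℕ → ℕ → ℕ → Prop}
    (hR : PrimrecPred fun q : ((ModelCode × ℕ) × ℕ) × ℕ => R q.1.1.1 q.1.1.2 q.1.2 q.2) :
    PrimrecPred fun p : ModelCode => ∀ i < p.2.1, ∀ a < p.1 + 1, ∀ b < p.1 + 1,
      IsCode P a → IsCode P b → 7 * Nat.pair a b + t ≤ p.1 →
        (p.lab i (7 * Nat.pair a b + t) ↔ R p i a b) := by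
  have hb : Primrec fun q : ((ModelCode × ℕ) × ℕ) × ℕ => q.2 := Primrec.snd
  have ha : Primrec fun q : ((ModelCode × ℕ) × ℕ) × ℕ => q.1.2 := Primrec.snd.comp Primrec.fst
  have hi : Primrec fun q : ((ModelCode × ℕ) × ℕ) × ℕ => q.1.1.2 :=
    Primrec.snd.comp (Primrec.fst.comp Primrec.fst)
  have hp : Primrec fun q : ((ModelCode × ℕ) × ℕ) × ℕ => q.1.1.1 :=
    Primrec.fst.comp (Primrec.fst.comp Primrec.fst)
  have hn := primrec_code (Primrec₂.natPair.comp ha hb) t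
  refine primrecPred_forall_lt (primrec_size Primrec.id) (primrecPred_forall_lt
    (primrec_bound Primrec.fst) (primrecPred_forall_lt
    (primrec_bound (Primrec.fst.comp Primrec.fst)) ?_))
  exact primrecPred_imp ((primrecPred_isCode P).comp ha) <|
    primrecPred_imp ((primrecPred_isCode P).comp hb) <|
    primrecPred_imp (Primrec.nat_le.comp hn (Primrec.fst.comp hp)) <|
    primrecPred_iff (primrecPred_lab hp hi hn) hR

/-- A clause about a world and a Gödel number, as in `Refutes`, is primitive recursive. -/
theorem primrecPred_unary (P : Type v) [Primcodable P] (t : ℕ) {R : ModelCode → ℕ → ℕ → Prop}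
    (hR : PrimrecPred fun q : (ModelCode × ℕ) × ℕ => R q.1.1 q.1.2 q.2) :
    PrimrecPred fun p : ModelCode => ∀ i < p.2.1, ∀ a < p.1 + 1, IsCode P a → 7 * a + t ≤ p.1 →
      (p.lab i (7 * a + t) ↔ R p i a) := by
  have hp : Primrec fun q : (ModelCode × ℕ) × ℕ => q.1.1 := Primrec.fst.comp Primrec.fst
  have hn := primrec_code (Primrec.snd (α := ModelCode × ℕ) (β := ℕ)) t
  refine primrecPred_forall_lt (primrec_size Primrec.id) (primrecPred_forall_lt
    (primrec_bound Primrec.fst) ?_)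
  exact primrecPred_imp ((primrecPred_isCode P).comp Primrec.snd) <|
    primrecPred_imp (Primrec.nat_le.comp hn (Primrec.fst.comp hp)) <|
    primrecPred_iff (primrecPred_lab hp (Primrec.snd.comp Primrec.fst) hn) hR

theorem primrecPred_refutes (P : Type v) [Primcodable P] :
    PrimrecPred fun p : ModelCode => Refutes P p := by
  have hrefl : PrimrecPred fun p : ModelCode => ∀ i < p.2.1, p.le i i :=
    primrecPred_forall_lt (primrec_size Primrec.id)
      (primrecPred_le Primrec.fst Primrec.snd Primrec.snd)
  have htrans : PrimrecPred fun p : ModelCode => ∀ i < p.2.1, ∀ j < p.2.1, ∀ k < p.2.1,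
      p.le i j → p.le j k → p.le i k := by
    have hp : Primrec fun q : ((ModelCode × ℕ) × ℕ) × ℕ => q.1.1.1 :=
      Primrec.fst.comp (Primrec.fst.comp Primrec.fst)
    have hi : Primrec fun q : ((ModelCode × ℕ) × ℕ) × ℕ => q.1.1.2 :=
      Primrec.snd.comp (Primrec.fst.comp Primrec.fst)
    have hj : Primrec fun q : ((ModelCode × ℕ) × ℕ) × ℕ => q.1.2 := Primrec.snd.comp Primrec.fst
    exact primrecPred_forall_lt (primrec_size Primrec.id) <|
      primrecPred_forall_lt (primrec_size Primrec.fst) <|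
      primrecPred_forall_lt (primrec_size (Primrec.fst.comp Primrec.fst)) <|
      primrecPred_imp (primrecPred_le hp hi hj) <|
      primrecPred_imp (primrecPred_le hp hj Primrec.snd) (primrecPred_le hp hi Primrec.snd)
  have hp : Primrec fun q : (ModelCode × ℕ) × ℕ => q.1.1 := Primrec.fst.comp Primrec.fst
  have hi : Primrec fun q : (ModelCode × ℕ) × ℕ => q.1.2 := Primrec.snd.comp Primrec.fst
  have hj : Primrec fun q : (ModelCode × ℕ) × ℕ => q.2 := Primrec.snd
  have hantisymm : PrimrecPred fun p : ModelCode => ∀ i < p.2.1, ∀ j < p.2.1,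
      p.le i j → p.le j i → i = j :=
    primrecPred_forall_lt (primrec_size Primrec.id) <|
      primrecPred_forall_lt (primrec_size Primrec.fst) <|
      primrecPred_imp (primrecPred_le hp hi hj) <|
      primrecPred_imp (primrecPred_le hp hj hi) (Primrec.eq.comp hi hj)
  have hmonotone : PrimrecPred fun p : ModelCode => ∀ i < p.2.1, ∀ j < p.2.1,
      p.le i j → p.le (p.succ i) (p.succ j) :=
    primrecPred_forall_lt (primrec_size Primrec.id) <|
      primrecPred_forall_lt (primrec_size Primrec.fst) <|
      primrecPred_imp (primrecPred_le hp hi hj) <|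
      primrecPred_le hp (primrec_succ hp hi) (primrec_succ hp hj)
  have hmono : PrimrecPred fun p : ModelCode => ∀ i < p.2.1, ∀ j < p.2.1, ∀ n < p.1 + 1,
      p.le i j → p.lab i n → p.lab j n :=
    primrecPred_forall_lt (primrec_size Primrec.id) <|
      primrecPred_forall_lt (primrec_size Primrec.fst) <|
      primrecPred_forall_lt (primrec_bound hp) <|
      primrecPred_imp ((primrecPred_le hp hi hj).comp Primrec.fst) <|
      primrecPred_imp (primrecPred_lab (hp.comp Primrec.fst) (hi.comp Primrec.fst) Primrec.snd) <|
      primrecPred_lab (hp.comp Primrec.fst) (hj.comp Primrec.fst) Primrec.snd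
  have hbot : PrimrecPred fun p : ModelCode => ∀ i < p.2.1, ¬ p.lab i 0 :=
    primrecPred_forall_lt (primrec_size Primrec.id)
      (primrecPred_lab Primrec.fst Primrec.snd (Primrec.const 0)).not
  have hand := primrecPred_binary P 5 (R := fun p i a b => p.lab i a ∧ p.lab i b) <|
    (primrecPred_lab (hp.comp Primrec.fst) (hi.comp Primrec.fst) (hj.comp Primrec.fst)).and
      (primrecPred_lab (hp.comp Primrec.fst) (hi.comp Primrec.fst) Primrec.snd)
  have hor := primrecPred_binary P 6 (R := fun p i a b => p.lab i a ∨ p.lab i b) <|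
    (primrecPred_lab (hp.comp Primrec.fst) (hi.comp Primrec.fst) (hj.comp Primrec.fst)).or
      (primrecPred_lab (hp.comp Primrec.fst) (hi.comp Primrec.fst) Primrec.snd)
  have himp := primrecPred_binary P 7
    (R := fun p i a b => ∀ j < p.2.1, p.le i j → p.lab j a → p.lab j b) <|
    primrecPred_forall_lt (primrec_size (hp.comp Primrec.fst)) <|
    primrecPred_imp (primrecPred_le (hp.comp (Primrec.fst.comp Primrec.fst))
      (hi.comp (Primrec.fst.comp Primrec.fst)) Primrec.snd) <|
    primrecPred_imp (primrecPred_lab (hp.comp (Primrec.fst.comp Primrec.fst)) Primrec.snd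
      (hj.comp (Primrec.fst.comp Primrec.fst))) <|
    primrecPred_lab (hp.comp (Primrec.fst.comp Primrec.fst)) Primrec.snd
      (Primrec.snd.comp Primrec.fst)
  have hnext := primrecPred_unary P 2 (R := fun p i a => p.lab (p.succ i) a) <|
    primrecPred_lab hp (primrec_succ hp hi) hj
  have hiter : PrimrecPred fun q : ((ModelCode × ℕ) × ℕ) × ℕ =>
      q.1.1.1.lab (q.1.1.1.succ^[q.2] q.1.1.2) q.1.2 :=
    primrecPred_lab (hp.comp Primrec.fst)
      (primrec_iterate (hp.comp Primrec.fst) (hi.comp Primrec.fst) Primrec.snd)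
      (hj.comp Primrec.fst)
  have hdiamond := primrecPred_unary P 3
    (R := fun p i a => ∃ k < p.2.1, p.lab (p.succ^[k] i) a) <|
    primrecPred_exists_lt (primrec_size hp) hiter
  have hbox := primrecPred_unary P 4 (R := fun p i a => ∀ k < p.2.1, p.lab (p.succ^[k] i) a) <|
    primrecPred_forall_lt (primrec_size hp) hiter
  have hfails : PrimrecPred fun p : ModelCode => ∃ i < p.2.1, ¬ p.lab i p.1 :=
    primrecPred_exists_lt (primrec_size Primrec.id)
      (primrecPred_lab Primrec.fst Primrec.snd (Primrec.fst.comp Primrec.fst)).not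
  refine (hrefl.and <| htrans.and <| hantisymm.and <| hmonotone.and <| hmono.and <| hbot.and <|
    hand.and <| hor.and <| himp.and <| hnext.and <| hdiamond.and <| hbox.and hfails).of_eq
    fun p => ⟨?_, ?_⟩
  · rintro ⟨h1, h2, h3, h4, h5, h6, h7, h8, h9, h10, h11, h12, h13⟩
    exact ⟨h1, h2, h3, h4, h5, h6, h7, h8, h9, h10, h11, h12, h13⟩
  · rintro ⟨h1, h2, h3, h4, h5, h6, h7, h8, h9, h10, h11, h12, h13⟩
    exact ⟨h1, h2, h3, h4, h5, h6, h7, h8, h9, h10, h11, h12, h13⟩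

end ModelCode

/-! ### Decidability of validity and satisfiability. -/

theorem computablePred_valid (P : Type v) [Primcodable P] :
    ComputablePred fun φ : Formula P => Valid.{u} φ := by
  have hc : Primrec fun φ : Formula P => φ.toNat := Primrec.encode
  have h : PrimrecPred fun φ : Formula P => ¬ Valid.{u} φ := by
    refine PrimrecPred.of_eq ?_ fun φ => (not_valid_iff.{u} φ).symm
    refine primrecPred_exists_lt (Primrec.succ.comp (primrec_sizeBound.comp hc)) ?_
    refine primrecPred_exists_lt (primrec_pow (Primrec.const 2)
      (primrec_mul Primrec.snd Primrec.snd)) ?_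
    refine primrecPred_exists_lt (primrec_pow (Primrec.snd.comp Primrec.fst)
      (Primrec.snd.comp Primrec.fst)) ?_
    refine primrecPred_exists_lt (primrec_pow (Primrec.const 2) (primrec_mul
      (Primrec.succ.comp (hc.comp (Primrec.fst.comp (Primrec.fst.comp Primrec.fst))))
      (Primrec.snd.comp (Primrec.fst.comp Primrec.fst)))) ?_
    exact (ModelCode.primrecPred_refutes P).comp (Primrec.pair
      (hc.comp (Primrec.fst.comp (Primrec.fst.comp (Primrec.fst.comp Primrec.fst))))
      (Primrec.pair (Primrec.snd.comp (Primrec.fst.comp (Primrec.fst.comp Primrec.fst)))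
      (Primrec.pair (Primrec.snd.comp (Primrec.fst.comp Primrec.fst))
      (Primrec.pair (Primrec.snd.comp Primrec.fst) Primrec.snd))))
  obtain ⟨_, h⟩ := h.not
  exact ComputablePred.of_eq ⟨_, h.to_comp⟩ fun φ => not_not

/-- A negation holds everywhere exactly when the negated formula holds nowhere, by reflexivity of
the order. -/
theorem satisfiable_iff {P : Type v} (φ : Formula P) :
    Satisfiable.{u} φ ↔ ¬ Valid.{u} (φ.imp .bot) := by
  constructor
  · rintro ⟨M, w, h⟩ hv
    exact hv M w w le_rfl h
  · intro h
    by_contra hno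
    exact h fun M w v _ hv => hno ⟨M, v, hv⟩

theorem primrec_imp_bot (P : Type v) [Primcodable P] :
    Primrec fun φ : Formula P => φ.imp .bot := by
  refine Primrec.encode_iff.1 ?_
  exact primrec_code (Primrec₂.natPair.comp Primrec.encode (Primrec.const 0)) 7

theorem computablePred_satisfiable (P : Type v) [Primcodable P] :
    ComputablePred fun φ : Formula P => Satisfiable.{u} φ := by
  obtain ⟨_, h⟩ := (computablePred_valid.{u} P).not
  have h' : Computable fun φ : Formula P => decide (¬ Valid.{u} (φ.imp .bot)) :=
    h.comp (primrec_imp_bot P).to_comp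
  exact ComputablePred.of_eq ⟨_, h'⟩ fun φ => (satisfiable_iff φ).symm

end ITL

theorem mainTheorem2 (P : Type v) [Primcodable P] :
    ComputablePred (fun φ : ITL.Formula P => ITL.Satisfiable.{u} φ) ∧
      ComputablePred (fun φ : ITL.Formula P => ITL.Valid.{u} φ) :=
  ⟨ITL.computablePred_satisfiable P, ITL.computablePred_valid P⟩
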